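/- Let $1 \le k \le n$ be integers. Let $I_{n,k} = \langle e_n, e_{n-1}, \dots, e_{n-k+1}, x_1^k, \dots, x_n^k\rangle \subseteq \mathbb{C}[x_1,\dots,x_n]$, where $e_r$ is the $r$-th elementary symmetric polynomial in $x_1,\dots,x_n$, and let $R_{n,k} = \mathbb{C}[x_1,\dots,x_n]/I_{n,k}$. Let $\mathcal{W}_{n,k}$ be the set of Fubini words of length $n$ with maximum letter $k$, i.e. of surjections $w : [n] \to [k]$. The symmetric group $S_n$ acts on $\mathcal{W}_{n,k}$ by $(v\cdot w)(i) = w(v^{-1}(i))$ and on $\mathbb{C}[x_1,\dots,x_n]$, hence on $R_{n,k}$, by $v\cdot x_i = x_{v(i)}$. For distinct $\alpha_1,\dots,\alpha_k \in \mathbb{C}$ let $Z_{n,k} = \{(\alpha_{w(1)},\dots,\alpha_{w(n)}) : w \in \mathcal{W}_{n,k}\} \subseteq \mathbb{C}^n$, let $\mathbf{I}(Z_{n,k})$ be the ideal of polynomials vanishing on $Z_{n,k}$, and for an ideal $I$ let $\mathrm{gr}\, I = \langle \tau(f) : 0 \ne f \in I\rangle$, where $\tau(f)$ is the homogeneous component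 of $f$ of highest degree. For a weak composition $\gamma = (\gamma_1,\dots,\gamma_n)$ the Demazure character $\kappa_\gamma$ is defined recursively by $\kappa_\gamma = x_1^{\gamma_1}\cdots x_n^{\gamma_n}$ if $\gamma_1 \ge \dots \ge \gamma_n$, and $\kappa_\gamma = \pi_i(\kappa_{s_i\cdot\gamma})$ if $\gamma_i < \gamma_{i+1}$, where $s_i$ swaps the $i$-th and $(i+1)$-st entries or variables and $\pi_i(f) = \frac{x_i f - x_{i+1}(s_i\cdot f)}{x_i - x_{i+1}}$. For $S = \{s_1 < \dots < s_r\} \subseteq [n]$ let $\gamma(S)$ be the sequence of length $n$ with $\gamma(S)_i = i - j + 1$ if $i = s_j$ and $\gamma(S)_i = 0$ if $i \notin S$, and let $\mathrm{rev}$ denote the reversal of a sequence. The neglex order is the lexicographic term order with respect to $x_n > \dots > x_2 > x_1$. A sequence $(c_1,\dots,c_n)$ of nonnegative integers is $(n,k)$-substaircase if it is componentwise $\le$ some shuffle of $(k-1,k-2,\dots,1,0)$ with $n-k$ copies of $k-1$; let $\mathcal{A}_{n,k}$ be the set of monomials $x_1^{c_1}\cdots x_n^{c_n}$ with $(c_1,\dots,c_n)$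 being $(n,k)$-substaircase. Then: 1. $\mathrm{gr}\,\mathbf{I}(Z_{n,k}) = I_{n,k}$, and $R_{n,k} = \mathbb{C}[x_1,\dots,x_n]/\mathrm{gr}\,\mathbf{I}(Z_{n,k}) \cong \mathbb{C}[\mathcal{W}_{n,k}]$ as ungraded $S_n$-modules. 2. The set $\{\kappa_{\mathrm{rev}(\gamma(S))} : S \subseteq [n],\ |S| = n-k+1\} \cup \{x_1^k,\dots,x_n^k\}$ is a Gröbner basis of $I_{n,k}$ with respect to the neglex order: it is a finite set of nonzero elements of $I_{n,k}$ whose initial monomials generate the initial ideal of $I_{n,k}$. 3. $\mathcal{A}_{n,k}$ is the standard monomial basis of $R_{n,k}$ with respect to the neglex order: it is the set of monomials not contained in the initial ideal of $I_{n,k}$, and its elements descend to a $\mathbb{C}$-basis of $R_{n,k}$. -/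

import Mathlib

noncomputable section

namespace OrbitHarmonics

open MvPolynomial

/-! ### The ideal `I_{n,k}` and the ring `R_{n,k}` -/

/-- The ideal `⟨e_n, e_{n-1}, …, e_{n-k+1}, x_1^k, …, x_n^k⟩` of `ℂ[x_1, …, x_n]`. -/
def idealI (n k : ℕ) : Ideal (MvPolynomial (Fin n) ℂ) :=
  Ideal.span ({f | ∃ r : ℕ, n - k + 1 ≤ r ∧ r ≤ n ∧ f = esymm (Fin n) ℂ r} ∪
    {f | ∃ i : Fin n, f = X i ^ k})

/-- The quotient ring `R_{n,k} = ℂ[x_1, …, x_n] / I_{n,k}`. -/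
abbrev ringR (n k : ℕ) : Type := MvPolynomial (Fin n) ℂ ⧸ idealI n k

/-- `I_{n,k}` is stable under permutations of the variables. -/
theorem idealI_le_comap (n k : ℕ) (v : Equiv.Perm (Fin n)) :
    idealI n k ≤ (idealI n k).comap (rename v : MvPolynomial (Fin n) ℂ →ₐ[ℂ] _) := by
  refine Ideal.span_le.2 ?_
  rintro f (⟨r, h1, h2, rfl⟩ | ⟨i, rfl⟩)
  · refine Ideal.subset_span (Or.inl ⟨r, h1, h2, ?_⟩)
    exact rename_esymm (Fin n) ℂ r v
  · refine Ideal.subset_span (Or.inr ⟨v i, ?_⟩)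
    simp

/-- The action of `S_n` on `R_{n,k}` induced by `v · x_i = x_{v(i)}`, that is
`(v · f)(x_1, …, x_n) = f(x_{v(1)}, …, x_{v(n)})`. -/
def repR (n k : ℕ) : Representation ℂ (Equiv.Perm (Fin n)) (ringR n k) where
  toFun v := (Ideal.quotientMapₐ (idealI n k)
    (rename v : MvPolynomial (Fin n) ℂ →ₐ[ℂ] _) (idealI_le_comap n k v)).toLinearMap
  map_one' := by
    refine LinearMap.ext fun x => ?_
    obtain ⟨f, rfl⟩ := Ideal.Quotient.mk_surjective x
    change Ideal.Quotient.mk (idealI n k) (rename (id : Fin n → Fin n) f) = _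
    rw [rename_id_apply]
    rfl
  map_mul' v u := by
    refine LinearMap.ext fun x => ?_
    obtain ⟨f, rfl⟩ := Ideal.Quotient.mk_surjective x
    change Ideal.Quotient.mk (idealI n k) (rename (v ∘ u) f) =
      Ideal.Quotient.mk (idealI n k) (rename v (rename u f))
    rw [rename_rename]

/-- The action on `R_{n,k}` on residue classes of polynomials. -/
theorem repR_mk (n k : ℕ) (v : Equiv.Perm (Fin n)) (f : MvPolynomial (Fin n) ℂ) :
    repR n k v (Ideal.Quotient.mk _ f) = Ideal.Quotient.mk (idealI n k) (rename v f) := rfl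

/-! ### Fubini words -/

/-- Fubini words of length `n` with maximum letter `k`, seen as surjections `[n] → [k]`
(the letter `a ∈ {1, …, k}` is the element `a - 1` of `Fin k`). -/
abbrev FubiniWord (n k : ℕ) : Type := {w : Fin n → Fin k // Function.Surjective w}

/-- `v · [w(1), …, w(n)] = [w(v⁻¹(1)), …, w(v⁻¹(n))]`. -/
instance fubiniAction (n k : ℕ) : MulAction (Equiv.Perm (Fin n)) (FubiniWord n k) where
  smul v w := ⟨fun i => w.1 (v⁻¹ i), w.2.comp (v⁻¹).surjective⟩
  one_smul _ := rfl
  mul_smul v u w := by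
    apply Subtype.ext
    funext i
    change w.1 ((v * u)⁻¹ i) = w.1 (u⁻¹ (v⁻¹ i))
    rw [mul_inv_rev, Equiv.Perm.mul_apply]

/-- The permutation representation of `S_n` on the vector space `ℂ[W_{n,k}]` with basis the
Fubini words. -/
abbrev repFubini (n k : ℕ) := Representation.ofMulAction ℂ (Equiv.Perm (Fin n)) (FubiniWord n k)

/-! ### Orbit harmonics -/

/-- The point locus `{(α_{w(1)}, …, α_{w(n)}) : w a Fubini word}` in `ℂⁿ`. -/
def locusZ (n k : ℕ) (α : Fin k → ℂ) : Set (Fin n → ℂ) :=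
  Set.range fun w : FubiniWord n k => fun i => α (w.1 i)

/-- The highest degree homogeneous component `τ(f)`. -/
def topComponent {n : ℕ} (f : MvPolynomial (Fin n) ℂ) : MvPolynomial (Fin n) ℂ :=
  homogeneousComponent f.totalDegree f

/-- The associated graded ideal `gr I = ⟨τ(f) : f ∈ I ∖ {0}⟩`. -/
def grIdeal {n : ℕ} (I : Ideal (MvPolynomial (Fin n) ℂ)) : Ideal (MvPolynomial (Fin n) ℂ) :=
  Ideal.span {g | ∃ f ∈ I, f ≠ 0 ∧ g = topComponent f}

/-! ### Gröbner bases and the neglex order -/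

/-- The lexicographic order with respect to `x_n > ⋯ > x_2 > x_1`. -/
def neglex (n : ℕ) : MonomialOrder (Fin n) where
  syn := (MonomialOrder.lex (σ := (Fin n)ᵒᵈ)).syn
  toSyn := (Finsupp.domCongr OrderDual.toDual).trans
    (MonomialOrder.lex (σ := (Fin n)ᵒᵈ)).toSyn
  toSyn_monotone := by
    intro a b h
    exact (MonomialOrder.lex (σ := (Fin n)ᵒᵈ)).toSyn_monotone fun i => h (OrderDual.ofDual i)

open scoped MonomialOrder in
/-- The explicit description of the order: `x^a < x^b` iff for some `i` one has `a_i < b_i` and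
`a_j = b_j` for all `j > i`. -/
theorem neglex_lt_iff {n : ℕ} (a b : Fin n →₀ ℕ) :
    a ≺[neglex n] b ↔ ∃ i, a i < b i ∧ ∀ j, i < j → a j = b j := by
  have key : a ≺[neglex n] b ↔ toLex (Finsupp.domCongr (M := ℕ) OrderDual.toDual a) <
      toLex (Finsupp.domCongr (M := ℕ) OrderDual.toDual b) := Iff.rfl
  rw [key, Finsupp.Lex.lt_iff]
  constructor
  · rintro ⟨i, h1, h2⟩
    exact ⟨OrderDual.ofDual i, h2, fun j hj => h1 (OrderDual.toDual j) hj⟩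
  · rintro ⟨i, h1, h2⟩
    exact ⟨OrderDual.toDual i, fun j hj => h2 (OrderDual.ofDual j) hj, h1⟩

/-- The initial monomial `in_<(f)`, the largest monomial appearing in `f` (for `f ≠ 0`). -/
def initialMonomial {n : ℕ} (m : MonomialOrder (Fin n)) (f : MvPolynomial (Fin n) ℂ) :
    MvPolynomial (Fin n) ℂ :=
  monomial (m.degree f) 1

/-- The initial ideal `in_<(I) = ⟨in_<(f) : 0 ≠ f ∈ I⟩`. -/
def initialIdeal {n : ℕ} (m : MonomialOrder (Fin n)) (I : Ideal (MvPolynomial (Fin n) ℂ)) :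
    Ideal (MvPolynomial (Fin n) ℂ) :=
  Ideal.span {g | ∃ f ∈ I, f ≠ 0 ∧ g = initialMonomial m f}

/-- `G` is a Gröbner basis of `I`: a finite set of nonzero elements of `I` whose initial monomials
generate the initial ideal of `I`. -/
structure IsGroebnerBasis {n : ℕ} (m : MonomialOrder (Fin n))
    (G : Set (MvPolynomial (Fin n) ℂ)) (I : Ideal (MvPolynomial (Fin n) ℂ)) : Prop where
  finite : G.Finite
  subset : ∀ g ∈ G, g ∈ I
  ne_zero : ∀ g ∈ G, g ≠ 0
  span_initial : initialIdeal m I = Ideal.span (initialMonomial m '' G)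

/-- The monomials not contained in the initial ideal of `I`. -/
def standardMonomials {n : ℕ} (m : MonomialOrder (Fin n))
    (I : Ideal (MvPolynomial (Fin n) ℂ)) : Set (MvPolynomial (Fin n) ℂ) :=
  {p | ∃ a : Fin n →₀ ℕ, p = monomial a 1 ∧ p ∉ initialIdeal m I}

/-! ### Demazure characters -/

theorem X_sub_X_dvd {n : ℕ} (i j : Fin n) (f : MvPolynomial (Fin n) ℂ) :
    (X i - X j) ∣ X i * f - X j * rename (Equiv.swap i j) f := by
  have key : (X i - X j : MvPolynomial (Fin n) ℂ) ∣ f - rename (Equiv.swap i j) f := by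
    induction f using MvPolynomial.induction_on with
    | C a => simp
    | add p q hp hq =>
      have := dvd_add hp hq
      rw [map_add]
      convert this using 1
      ring
    | mul_X p l hp =>
      have hl : (X i - X j : MvPolynomial (Fin n) ℂ) ∣ X l - X (Equiv.swap i j l) := by
        by_cases h1 : l = i
        · subst h1; simp
        · by_cases h2 : l = j
          · subst h2
            rw [Equiv.swap_apply_right, dvd_sub_comm]
          · simp [Equiv.swap_apply_of_ne_of_ne h1 h2]
      have := dvd_add (hp.mul_right (X l)) (hl.mul_left (rename (Equiv.swap i j) p))
      rw [map_mul, rename_X]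
      convert this using 1
      ring
  have := dvd_add (key.mul_left (X i)) (dvd_mul_right (X i - X j) (rename (Equiv.swap i j) f))
  convert this using 1
  ring

/-- The isobaric divided difference `(x_i f - x_j (s · f)) / (x_i - x_j)`, where `s` swaps `x_i`
and `x_j`; it is used for `j = i + 1`. -/
def isobaric {n : ℕ} (i j : Fin n) (f : MvPolynomial (Fin n) ℂ) : MvPolynomial (Fin n) ℂ :=
  (X_sub_X_dvd i j f).choose

theorem isobaric_spec {n : ℕ} (i j : Fin n) (f : MvPolynomial (Fin n) ℂ) :
    (X i - X j) * isobaric i j f = X i * f - X j * rename (Equiv.swap i j) f :=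
  (X_sub_X_dvd i j f).choose_spec.symm

theorem X_sub_X_ne_zero {n : ℕ} {i j : Fin n} (h : i ≠ j) :
    (X i - X j : MvPolynomial (Fin n) ℂ) ≠ 0 :=
  sub_ne_zero.2 fun e => h (X_injective e)

/-- The quantity `∑ i · γ_i` that drops when an ascent is swapped. -/
def weight {n : ℕ} (γ : Fin n → ℕ) : ℕ := ∑ i : Fin n, (i : ℕ) * γ i

theorem weight_swap_lt {n : ℕ} {γ : Fin n → ℕ} {i j : Fin n} (hij : (i : ℕ) + 1 = j)
    (h : γ i < γ j) : weight (γ ∘ Equiv.swap i j) < weight γ := by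
  have hne : j ≠ i := by rintro rfl; omega
  have e : ∀ δ : Fin n → ℕ, weight δ = (i : ℕ) * δ i + ((j : ℕ) * δ j +
      ∑ l ∈ (Finset.univ.erase i).erase j, (l : ℕ) * δ l) := by
    intro δ
    rw [weight, ← Finset.add_sum_erase _ _ (Finset.mem_univ i),
      ← Finset.add_sum_erase (Finset.univ.erase i) _ (by simp [hne] : j ∈ Finset.univ.erase i)]
  have hs : ∑ l ∈ (Finset.univ.erase i).erase j, (l : ℕ) * (γ ∘ Equiv.swap i j) l =
      ∑ l ∈ (Finset.univ.erase i).erase j, (l : ℕ) * γ l := by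
    refine Finset.sum_congr rfl fun l hl => ?_
    simp only [Finset.mem_erase] at hl
    simp [Equiv.swap_apply_of_ne_of_ne hl.2.1 hl.1]
  rw [e, e γ, hs]
  simp only [Function.comp_apply, Equiv.swap_apply_left, Equiv.swap_apply_right, ← hij]
  nlinarith

/-- The Demazure character (key polynomial) `κ_γ`: if `γ_i < γ_{i+1}` for some `i`, then
`κ_γ = π_i(κ_{s_i γ})`; otherwise `γ` is weakly decreasing and `κ_γ = x^γ`. The ascent used
is immaterial, see `demazure_of_ascent`. -/
def demazure {n : ℕ} (γ : Fin n → ℕ) : MvPolynomial (Fin n) ℂ :=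
  open Classical in
  if h : ∃ p : Fin n × Fin n, (p.1 : ℕ) + 1 = p.2 ∧ γ p.1 < γ p.2 then
    isobaric h.choose.1 h.choose.2 (demazure (γ ∘ Equiv.swap h.choose.1 h.choose.2))
  else ∏ i : Fin n, X i ^ γ i
termination_by weight γ
decreasing_by exact weight_swap_lt h.choose_spec.1 h.choose_spec.2

/-- First clause of the recursion. -/
theorem demazure_of_antitone {n : ℕ} {γ : Fin n → ℕ} (hγ : Antitone γ) :
    demazure γ = ∏ i : Fin n, X i ^ γ i := by
  rw [demazure, dif_neg]
  rintro ⟨p, h1, h2⟩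
  exact absurd (hγ (show p.1 ≤ p.2 from Fin.le_def.2 (by omega))) (not_le.2 h2)

theorem isobaric_comm {n : ℕ} {i j p q : Fin n} (hij : i ≠ j) (hpq : p ≠ q)
    (hip : i ≠ p) (hiq : i ≠ q) (hjp : j ≠ p) (hjq : j ≠ q) (f : MvPolynomial (Fin n) ℂ) :
    isobaric i j (isobaric p q f) = isobaric p q (isobaric i j f) := by
  have hst : rename (Equiv.swap i j) (rename (Equiv.swap p q) f) =
      rename (Equiv.swap p q) (rename (Equiv.swap i j) f) := by
    rw [rename_rename, rename_rename]
    congr 1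
    congr 1
    ext x
    simp only [Function.comp_apply, Equiv.swap_apply_def]
    grind
  have a1 := isobaric_spec p q f
  have a2 := congrArg (rename (Equiv.swap i j)) a1
  have a3 := isobaric_spec i j (isobaric p q f)
  have b1 := isobaric_spec i j f
  have b2 := congrArg (rename (Equiv.swap p q)) b1
  have b3 := isobaric_spec p q (isobaric i j f)
  simp only [map_mul, map_sub, rename_X, Equiv.swap_apply_of_ne_of_ne hip hiq,
    Equiv.swap_apply_of_ne_of_ne hjp hjq, Equiv.swap_apply_of_ne_of_ne hip.symm hjp.symm,
    Equiv.swap_apply_of_ne_of_ne hiq.symm hjq.symm] at a2 b2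
  refine mul_left_cancel₀ (mul_ne_zero (X_sub_X_ne_zero hij) (X_sub_X_ne_zero hpq)) ?_
  linear_combination (X p - X q) * a3 + X i * a1 - X j * a2 - (X i - X j) * b3 - X p * b1
    + X q * b2 + X j * X q * hst

theorem isobaric_braid {n : ℕ} {i j l : Fin n} (hij : i ≠ j) (hjl : j ≠ l) (hil : i ≠ l)
    (f : MvPolynomial (Fin n) ℂ) :
    isobaric i j (isobaric j l (isobaric i j f)) =
      isobaric j l (isobaric i j (isobaric j l f)) := by
  have sij : Equiv.swap i j l = l := Equiv.swap_apply_of_ne_of_ne hil.symm hjl.symm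
  have sjl : Equiv.swap j l i = i := Equiv.swap_apply_of_ne_of_ne hij hil
  have invol : ∀ (p q : Fin n) (g : MvPolynomial (Fin n) ℂ),
      rename (Equiv.swap p q) (rename (Equiv.swap p q) g) = g := by
    intro p q g
    rw [rename_rename]
    have : (⇑(Equiv.swap p q) ∘ ⇑(Equiv.swap p q)) = id := by ext x; simp
    rw [this, rename_id_apply]
  have fixed : ∀ {p q : Fin n} (_ : p ≠ q) (g : MvPolynomial (Fin n) ℂ),
      rename (Equiv.swap p q) (isobaric p q g) = isobaric p q g := by
    intro p q hpq g
    have c1 := isobaric_spec p q g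
    have c2 := congrArg (rename (Equiv.swap p q)) c1
    simp only [map_mul, map_sub, rename_X, Equiv.swap_apply_left, Equiv.swap_apply_right,
      invol] at c2
    refine mul_left_cancel₀ (X_sub_X_ne_zero hpq) ?_
    linear_combination -c2 - c1
  have hst : rename (Equiv.swap i j) (rename (Equiv.swap j l) (rename (Equiv.swap i j) f)) =
      rename (Equiv.swap j l) (rename (Equiv.swap i j) (rename (Equiv.swap j l) f)) := by
    simp only [rename_rename]
    congr 1
    congr 1
    ext x
    simp only [Function.comp_apply, Equiv.swap_apply_def]
    grind
  have a1 := isobaric_spec i j f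
  have a2 := congrArg (rename (Equiv.swap j l)) a1
  have a3 := isobaric_spec j l (isobaric i j f)
  have a4 := congrArg (rename (Equiv.swap i j)) a3
  simp only [map_mul, map_sub, rename_X, Equiv.swap_apply_left, Equiv.swap_apply_right,
    sij, sjl, fixed hij] at a2 a4
  have a5 := congrArg (rename (Equiv.swap i j)) a2
  have a6 := isobaric_spec i j (isobaric j l (isobaric i j f))
  have b1 := isobaric_spec j l f
  have b2 := congrArg (rename (Equiv.swap i j)) b1
  have b3 := isobaric_spec i j (isobaric j l f)
  have b4 := congrArg (rename (Equiv.swap j l)) b3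
  simp only [map_mul, map_sub, rename_X, Equiv.swap_apply_left, Equiv.swap_apply_right,
    sij, sjl, fixed hjl] at b2 b4
  have b5 := congrArg (rename (Equiv.swap j l)) b2
  have b6 := isobaric_spec j l (isobaric i j (isobaric j l f))
  simp only [map_mul, map_sub, rename_X, Equiv.swap_apply_left, Equiv.swap_apply_right,
    sij, sjl] at a5 b5
  refine mul_left_cancel₀ (mul_ne_zero (mul_ne_zero (X_sub_X_ne_zero hij) (X_sub_X_ne_zero hjl))
    (X_sub_X_ne_zero hil)) ?_
  have L : (X i - X j) * (X j - X l) * (X i - X l) *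
      isobaric i j (isobaric j l (isobaric i j f)) =
      X i ^ 2 * X j * f - X i * X j ^ 2 * rename (Equiv.swap i j) f
      - X i ^ 2 * X l * rename (Equiv.swap j l) f
      + X i * X l ^ 2 * rename (Equiv.swap j l) (rename (Equiv.swap i j) f)
      + X j ^ 2 * X l * rename (Equiv.swap i j) (rename (Equiv.swap j l) f)
      - X j * X l ^ 2 *
        rename (Equiv.swap i j) (rename (Equiv.swap j l) (rename (Equiv.swap i j) f)) := by
    linear_combination (X j - X l) * (X i - X l) * a6 + X i * (X i - X l) * a3
      - X j * (X j - X l) * a4 + X i * X j * a1 - X i * X l * a2 + X j * X l * a5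
  have M : (X i - X j) * (X j - X l) * (X i - X l) *
      isobaric j l (isobaric i j (isobaric j l f)) =
      X i ^ 2 * X j * f - X i * X j ^ 2 * rename (Equiv.swap i j) f
      - X i ^ 2 * X l * rename (Equiv.swap j l) f
      + X i * X l ^ 2 * rename (Equiv.swap j l) (rename (Equiv.swap i j) f)
      + X j ^ 2 * X l * rename (Equiv.swap i j) (rename (Equiv.swap j l) f)
      - X j * X l ^ 2 *
        rename (Equiv.swap j l) (rename (Equiv.swap i j) (rename (Equiv.swap j l) f)) := by
    linear_combination (X i - X j) * (X i - X l) * b6 + X j * (X i - X l) * b3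
      - X l * (X i - X j) * b4 + X i ^ 2 * b1 - X j ^ 2 * b2 + X l ^ 2 * b5
  rw [L, M, hst]

/-- Second clause of the recursion: it holds for every ascent of `γ`. -/
theorem demazure_of_ascent {n : ℕ} (γ : Fin n → ℕ) (i j : Fin n) (hij : (i : ℕ) + 1 = j)
    (h : γ i < γ j) : demazure γ = isobaric i j (demazure (γ ∘ Equiv.swap i j)) := by
  induction hw : weight γ using Nat.strong_induction_on generalizing γ i j with
  | _ w ih =>
  subst hw
  have step : ∀ (δ : Fin n → ℕ), weight δ < weight γ → ∀ p q : Fin n, (p : ℕ) + 1 = q →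
      δ p < δ q → demazure δ = isobaric p q (demazure (δ ∘ Equiv.swap p q)) :=
    fun δ hδ p q hpq hlt => ih _ hδ δ p q hpq hlt rfl
  have braid : ∀ a b c : Fin n, (a : ℕ) + 1 = b → (b : ℕ) + 1 = c → γ a < γ b → γ b < γ c →
      isobaric a b (demazure (γ ∘ Equiv.swap a b)) =
        isobaric b c (demazure (γ ∘ Equiv.swap b c)) := by
    intro a b c hab hbc h1 h2
    have nab : a ≠ b := by rintro rfl; omega
    have nbc : b ≠ c := by rintro rfl; omega
    have nac : a ≠ c := by rintro rfl; omega
    have sab : Equiv.swap a b c = c := Equiv.swap_apply_of_ne_of_ne nac.symm nbc.symm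
    have sbc : Equiv.swap b c a = a := Equiv.swap_apply_of_ne_of_ne nab nac
    have w1 := weight_swap_lt hab h1
    have w2 := weight_swap_lt hbc h2
    have v1 : (γ ∘ Equiv.swap a b) b < (γ ∘ Equiv.swap a b) c := by
      simpa [sab] using h1.trans h2
    have v2 : (γ ∘ Equiv.swap b c) a < (γ ∘ Equiv.swap b c) b := by
      simpa [sbc] using h1.trans h2
    have u1 := weight_swap_lt hbc v1
    have u2 := weight_swap_lt hab v2
    rw [step _ w1 b c hbc v1, step _ w2 a b hab v2,
      step _ (u1.trans w1) a b hab (by simpa [sab, sbc] using h2),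
      step _ (u2.trans w2) b c hbc (by simpa [sab, sbc] using h1),
      isobaric_braid nab nbc nac]
    congr 4
    ext x
    simp only [Function.comp_apply, Equiv.swap_apply_def]
    grind
  have hex : ∃ p : Fin n × Fin n, (p.1 : ℕ) + 1 = p.2 ∧ γ p.1 < γ p.2 := ⟨(i, j), hij, h⟩
  rw [demazure, dif_pos hex]
  generalize hex.choose = pq, hex.choose_spec = hpq
  obtain ⟨p, q⟩ := pq
  obtain ⟨hpq, hlt⟩ := hpq
  dsimp only at hpq hlt ⊢
  by_cases c1 : p = i
  · have : q = j := Fin.ext (by rw [← hpq, ← hij, c1])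
    rw [c1, this]
  by_cases c2 : q = i
  · subst c2
    exact braid p q j hpq hij hlt h
  by_cases c3 : j = p
  · subst c3
    exact (braid i j q hij hpq h hlt).symm
  have c4 : q ≠ j := fun e => c1 (Fin.ext (by have := congrArg Fin.val e; omega))
  have nij : i ≠ j := by rintro rfl; omega
  have npq : p ≠ q := by rintro rfl; omega
  have v1 : (γ ∘ Equiv.swap p q) i < (γ ∘ Equiv.swap p q) j := by
    simpa [Equiv.swap_apply_of_ne_of_ne (Ne.symm c1) (Ne.symm c2),
      Equiv.swap_apply_of_ne_of_ne c3 c4.symm] using h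
  have v2 : (γ ∘ Equiv.swap i j) p < (γ ∘ Equiv.swap i j) q := by
    simpa [Equiv.swap_apply_of_ne_of_ne c1 (Ne.symm c3),
      Equiv.swap_apply_of_ne_of_ne c2 c4] using hlt
  rw [step _ (weight_swap_lt hpq hlt) i j hij v1, step _ (weight_swap_lt hij h) p q hpq v2,
    isobaric_comm npq nij c1 (Ne.symm c3) c2 c4]
  have hc : (γ ∘ Equiv.swap p q) ∘ Equiv.swap i j = (γ ∘ Equiv.swap i j) ∘ Equiv.swap p q := by
    have : (Equiv.swap p q : Fin n → Fin n) ∘ Equiv.swap i j =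
        (Equiv.swap i j : Fin n → Fin n) ∘ Equiv.swap p q := by
      clear * - nij npq c1 c2 c3 c4
      ext x
      simp only [Function.comp_apply, Equiv.swap_apply_def]
      grind
    rw [Function.comp_assoc, this, Function.comp_assoc]
  rw [hc]

/-- The skip sequence of `S = {s_1 < ⋯ < s_r}`: `γ(S)_i = i - j + 1` if `i = s_j`, and
`γ(S)_i = 0` if `i ∉ S`. (In `Fin n` positions are counted from `0`, so `i` becomes
`i + 1`, and `j - 1` is the number of elements of `S` below `i`.) -/
def skip {n : ℕ} (S : Finset (Fin n)) (i : Fin n) : ℕ :=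
  if i ∈ S then (i : ℕ) + 1 - (S.filter (· < i)).card else 0

/-- The polynomials `κ_{rev(γ(S))}` for `|S| = n - k + 1`, and the powers `x_1^k, …, x_n^k`. -/
def groebnerSet (n k : ℕ) : Set (MvPolynomial (Fin n) ℂ) :=
  {f | ∃ S : Finset (Fin n), S.card = n - k + 1 ∧ f = demazure (fun i => skip S i.rev)} ∪
    {f | ∃ i : Fin n, f = X i ^ k}

/-! ### Substaircase monomials -/

/-- `b` is a shuffle of `(k-1, k-2, …, 1, 0)` with `n - k` copies of `k - 1`; here `T` is the set of
positions occupied by the first sequence. -/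
def IsStaircase (n k : ℕ) (b : Fin n → ℕ) : Prop :=
  ∃ T : Finset (Fin n), T.card = k ∧
    ∀ i, b i = if i ∈ T then k - 1 - (T.filter (· < i)).card else k - 1

/-- `(c_1, …, c_n)` is componentwise at most some `(n,k)`-staircase. -/
def IsSubstaircase (n k : ℕ) (c : Fin n → ℕ) : Prop :=
  ∃ b, IsStaircase n k b ∧ ∀ i, c i ≤ b i

/-- The set `A_{n,k}` of `(n,k)`-substaircase monomials. -/
def substaircaseMonomials (n k : ℕ) : Set (MvPolynomial (Fin n) ℂ) :=
  {p | ∃ a : Fin n →₀ ℕ, IsSubstaircase n k a ∧ p = monomial a 1}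

end OrbitHarmonics

end

namespace OrbitHarmonics

/-! ### The greedy statistic and nonskip sequences -/

/-! The proof squeezes the dimension of $R_{n,k}$ between two bounds that turn out to be equal;
every assertion is then a consequence of equality.

Lower bound. The polynomials $\prod_j (x_i-\alpha_j)$ and the coefficients of $t^r$, $r>n-k$, in
$\prod_l(1-x_lt)/\prod_j(1-\alpha_jt)$ vanish on $Z_{n,k}$, and their top components are $x_i^k$ and
$\pm e_r$. Hence $I_{n,k}\subseteq \mathrm{gr}\,\mathbf I(Z_{n,k})$ (`idealI_le_grIdeal`). Averaging
over $S_n$ gives an equivariant linear map which identifies the quotient by $\mathrm{gr}\,\mathbf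
I(Z_{n,k})$ with the quotient by $\mathbf I(Z_{n,k})$ (`exists_equivariant_grading`), and the latter
is $\mathbb C[\mathcal W_{n,k}]$ by interpolation. So $R_{n,k}$ surjects equivariantly onto $\mathbb
C[\mathcal W_{n,k}]$.

Upper bound. When the nonzero parts of the composition decrease weakly, the Demazure character is a
flagged Schur function, that is, a Jacobi–Trudi determinant in complete symmetric polynomials of
initial segments of the variables (`demazure_eq_det`). The determinant gives both facts needed for
reversed skip sequences: membership in $I_{n,k}$, because modulo $I_{n,k}$ the matrix kills a vector
with an entry 1 (`det_flaggedMatrix_mem`), and the neglex leading monomial, which comes from the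
diagonal (`monic_det_flaggedMatrix`). A standard monomial is therefore divisible by no $x_i^k$ and
by no reversed skip monomial; a greedy scan of its exponents shows that it is substaircase
(`isSubstaircase_of_nonskip`). So substaircase monomials span $R_{n,k}$.

Equality. Substaircase sequences and Fubini words are equinumerous, since the scan and the count of
words containing prescribed letters obey the same recurrences (`card_isSubstaircase`). Thus the
surjection is an isomorphism with kernel 0, the spanning monomials are a basis, and no substaircase
monomial can be an initial monomial. -/

/-- Scan `c` from right to left with a counter starting at `0` which increases by one at each entry
that does not exceed its current value; the result is the final value of the counter. -/
def greedy : (n : ℕ) → (Fin n → ℕ) → ℕ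
  | 0, _ => 0
  | n + 1, c => greedy n (Fin.tail c) + if c 0 ≤ greedy n (Fin.tail c) then 1 else 0

theorem greedy_succ (n : ℕ) (c : Fin (n + 1) → ℕ) :
    greedy (n + 1) c = greedy n (Fin.tail c) + if c 0 ≤ greedy n (Fin.tail c) then 1 else 0 := rfl

theorem greedy_le (n : ℕ) (c : Fin n → ℕ) : greedy n c ≤ n := by
  induction n with
  | zero => exact le_rfl
  | succ n ih =>
    rw [greedy_succ]
    have := ih (Fin.tail c)
    split_ifs <;> omega

theorem card_filter_lt_map_succ {n : ℕ} (S : Finset (Fin n)) (i : Fin n) :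
    ((S.map (Fin.succEmb n)).filter (i.succ < ·)).card = (S.filter (i < ·)).card := by
  rw [Finset.filter_map, Finset.card_map]
  congr 1
  ext j
  rw [Finset.mem_filter, Finset.mem_filter]
  simp

theorem card_filter_insert_zero {n : ℕ} (S : Finset (Fin n)) (i : Fin n) :
    ((insert 0 (S.map (Fin.succEmb n))).filter (i.succ < ·)).card = (S.filter (i < ·)).card := by
  rw [Finset.filter_insert, if_neg (by simp), card_filter_lt_map_succ]

theorem card_filter_zero_lt {n : ℕ} (S : Finset (Fin n)) :
    ((insert 0 (S.map (Fin.succEmb n))).filter (0 < ·)).card = S.card := by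
  rw [Finset.filter_insert, if_neg (by simp), Finset.filter_true_of_mem, Finset.card_map]
  simp

theorem card_insert_zero {n : ℕ} (S : Finset (Fin n)) :
    (insert 0 (S.map (Fin.succEmb n))).card = S.card + 1 := by
  rw [Finset.card_insert_of_notMem (by simp), Finset.card_map]

/-- The entries skipped by the scan yield a set `S` whose reversed skip sequence is below `c`. -/
theorem exists_skip_le (n : ℕ) (c : Fin n → ℕ) (r : ℕ) (hr : r + greedy n c ≤ n) :
    ∃ S : Finset (Fin n), S.card = r ∧
      ∀ i ∈ S, n ≤ c i + i + (S.filter (i < ·)).card := by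
  induction n generalizing r with
  | zero => exact ⟨∅, by simp; omega, by simp⟩
  | succ n ih =>
    rw [greedy_succ] at hr
    have lift : ∀ r', r' + greedy n (Fin.tail c) ≤ n → ∃ S : Finset (Fin (n + 1)), S.card = r' ∧
        ∀ i ∈ S, n + 1 ≤ c i + i + (S.filter (i < ·)).card := by
      intro r' hr'
      obtain ⟨S, hS, h⟩ := ih (Fin.tail c) r' hr'
      refine ⟨S.map (Fin.succEmb n), by simpa using hS, ?_⟩
      simp only [Finset.mem_map, Fin.coe_succEmb, forall_exists_index, and_imp]
      rintro _ i hi rfl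
      have := h i hi
      rw [card_filter_lt_map_succ]
      simp only [Fin.tail, Fin.val_succ] at this ⊢
      omega
    by_cases hle : r + greedy n (Fin.tail c) ≤ n
    · exact lift r hle
    -- Here the tail has fewer than `r` skipped entries, so position 0 must be skipped too and `r +
    -- greedy n (Fin.tail c) = n + 1`; all skips are used.
    · have hc : ¬ c 0 ≤ greedy n (Fin.tail c) := by
        intro hc
        rw [if_pos hc] at hr
        omega
      rw [if_neg hc] at hr
      have hg := greedy_le n (Fin.tail c)
      obtain ⟨S, hS, h⟩ := ih (Fin.tail c) (r - 1) (by omega)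
      refine ⟨insert 0 (S.map (Fin.succEmb n)), by rw [card_insert_zero]; omega, ?_⟩
      intro i hi
      simp only [Finset.mem_insert, Finset.mem_map, Fin.coe_succEmb] at hi
      obtain rfl | ⟨i, hi, rfl⟩ := hi
      · rw [card_filter_zero_lt]
        simp only [Fin.val_zero]
        omega
      · have := h i hi
        rw [card_filter_insert_zero]
        simp only [Fin.tail, Fin.val_succ] at this ⊢
        omega

/-- The positions at which the counter increases form such a set: the counter value on reaching one
of them is the number of those to its right. The `r` rightmost ones are kept. -/
theorem exists_staircase_of_le_greedy (n : ℕ) (c : Fin n → ℕ) (r : ℕ) (hr : r ≤ greedy n c) :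
    ∃ T : Finset (Fin n), T.card = r ∧ ∀ i ∈ T, c i ≤ (T.filter (i < ·)).card := by
  induction n generalizing r with
  | zero => exact ⟨∅, by simpa [greedy, eq_comm] using hr, by simp⟩
  | succ n ih =>
    rw [greedy_succ] at hr
    by_cases hle : r ≤ greedy n (Fin.tail c)
    · obtain ⟨S, hS, h⟩ := ih (Fin.tail c) r hle
      refine ⟨S.map (Fin.succEmb n), by simpa using hS, ?_⟩
      simp only [Finset.mem_map, Fin.coe_succEmb, forall_exists_index, and_imp]
      rintro _ i hi rfl
      rw [card_filter_lt_map_succ]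
      exact h i hi
    · have hc : c 0 ≤ greedy n (Fin.tail c) := by
        by_contra hc
        rw [if_neg hc] at hr
        omega
      rw [if_pos hc] at hr
      obtain ⟨S, hS, h⟩ := ih (Fin.tail c) (r - 1) (by omega)
      refine ⟨insert 0 (S.map (Fin.succEmb n)), by rw [card_insert_zero]; omega, ?_⟩
      intro i hi
      simp only [Finset.mem_insert, Finset.mem_map, Fin.coe_succEmb] at hi
      obtain rfl | ⟨i, hi, rfl⟩ := hi
      · rw [card_filter_zero_lt]
        omega
      · rw [card_filter_insert_zero]
        exact h i hi

/-- The scan is optimal: by induction its counter has reached at least the number of elements of `T`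
already passed, so it accepts whenever `T` does. -/
theorem card_le_greedy (n : ℕ) (c : Fin n → ℕ) (T : Finset (Fin n))
    (hT : ∀ i ∈ T, c i ≤ (T.filter (i < ·)).card) : T.card ≤ greedy n c := by
  induction n with
  | zero => simp [Finset.eq_empty_of_isEmpty T]
  | succ n ih =>
    obtain ⟨S, hS⟩ : ∃ S : Finset (Fin n), ∀ i, i ∈ S ↔ i.succ ∈ T :=
      ⟨Finset.univ.filter fun i => i.succ ∈ T, by simp⟩
    have hST : T.erase 0 = S.map (Fin.succEmb n) := by
      ext i
      cases i using Fin.cases <;> simp [hS]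
    have hf : ∀ i, (T.filter (i < ·)) = ((S.map (Fin.succEmb n)).filter (i < ·)) := by
      intro i
      rw [← hST]
      ext j
      simp only [Finset.mem_filter, Finset.mem_erase]
      constructor
      · rintro ⟨h1, h2⟩
        exact ⟨⟨(Fin.pos_of_ne_zero (Fin.ne_zero_of_lt h2)).ne', h1⟩, h2⟩
      · tauto
    have h1 := ih (Fin.tail c) S fun i hi => by
      have := hT i.succ ((hS i).1 hi)
      rwa [hf, card_filter_lt_map_succ] at this
    have hcard : (T.erase 0).card = S.card := by rw [hST, Finset.card_map]
    rw [greedy_succ]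
    by_cases h0 : (0 : Fin (n + 1)) ∈ T
    · have h2 := hT 0 h0
      rw [hf, Finset.filter_true_of_mem (by simp), Finset.card_map] at h2
      rw [if_pos (h2.trans h1)]
      have := Finset.card_erase_add_one h0
      omega
    · rw [Finset.erase_eq_of_notMem h0] at hcard
      omega

/-- `c` is `(n,k)`-substaircase iff its entries are below `k` and the scan reaches `k`. -/
theorem isSubstaircase_iff {n k : ℕ} (hk : 0 < k) (c : Fin n → ℕ) :
    IsSubstaircase n k c ↔ (∀ i, c i < k) ∧ k ≤ greedy n c := by
  -- When `T.card = k`, this turns the staircase value `k - 1 - #{j ∈ T, j < i}` into `#{j ∈ T, j >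
  -- i}`, the form met in the scan.
  have split : ∀ (T : Finset (Fin n)) (i : Fin n), i ∈ T →
      T.card = (T.filter (· < i)).card + (T.filter (i < ·)).card + 1 := by
    intro T i hi
    rw [← Finset.card_erase_add_one hi,
      ← Finset.card_filter_add_card_filter_not (s := T.erase i) (· < i)]
    congr 2
    · congr 1
      ext j
      simp only [Finset.mem_filter, Finset.mem_erase]
      exact ⟨fun h => ⟨h.1.2, h.2⟩, fun h => ⟨⟨h.2.ne, h.1⟩, h.2⟩⟩
    · congr 1
      ext j
      simp only [Finset.mem_filter, Finset.mem_erase, not_lt]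
      exact ⟨fun h => ⟨h.1.2, lt_of_le_of_ne h.2 (Ne.symm h.1.1)⟩,
        fun h => ⟨⟨h.2.ne', h.1⟩, h.2.le⟩⟩
  constructor
  · rintro ⟨b, ⟨T, hT, hb⟩, hcb⟩
    refine ⟨fun i => ?_, hT ▸ card_le_greedy n c T fun i hi => ?_⟩
    · have h1 := hcb i
      rw [hb] at h1
      split_ifs at h1 <;> omega
    · have h1 := hcb i
      rw [hb, if_pos hi] at h1
      have := split T i hi
      omega
  · rintro ⟨hc, hg⟩
    obtain ⟨T, hT, h⟩ := exists_staircase_of_le_greedy n c k hg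
    refine ⟨_, ⟨T, hT, fun i => rfl⟩, fun i => ?_⟩
    split_ifs with hi
    · have := split T i hi
      have := h i hi
      omega
    · have := hc i
      omega

/-! ### Counting -/

/-- The number of words of length `n` in `K` letters which contain `m` prescribed letters. -/
def wordCount (K : ℕ) : ℕ → ℕ → ℕ
  | 0, m => if m = 0 then 1 else 0
  | n + 1, m => (K - m) * wordCount K n m + m * wordCount K n (m - 1)

/-- Single out one of the letters that are not prescribed: a word either uses it or is a word in the
other `K` letters. The proof checks this on the recurrence. -/
theorem wordCount_succ_left (K n m : ℕ) (hm : m ≤ K) :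
    wordCount (K + 1) n m = wordCount (K + 1) n (m + 1) + wordCount K n m := by
  induction n generalizing m with
  | zero => simp [wordCount]
  | succ n ih =>
    simp only [wordCount]
    obtain ⟨l, rfl⟩ := Nat.exists_eq_add_of_le hm
    have h1 := ih m hm
    have e1 : m + l + 1 - m = l + 1 := by omega
    have e2 : m + l + 1 - (m + 1) = l := by omega
    have e3 : m + l - m = l := by omega
    rw [e1, e2, e3]
    cases m with
    | zero =>
      simp only [Nat.add_sub_cancel] at *
      rw [h1]
      ring
    | succ m =>
      have h2 := ih m (by omega)
      simp only [Nat.add_sub_cancel] at *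
      rw [h2, h1]
      ring

/-- Condition on the first letter: if it lies in `A`, one requirement fewer remains for the rest of
the word; otherwise all of them remain. -/
theorem card_words_containing (K n : ℕ) (A : Finset (Fin K)) :
    (Finset.univ.filter fun w : Fin n → Fin K => ∀ a ∈ A, ∃ i, w i = a).card =
      wordCount K n A.card := by
  induction n generalizing A with
  | zero =>
    rw [wordCount]
    split_ifs with h
    · rw [Finset.card_eq_zero.1 h]
      simp
    · obtain ⟨a, ha⟩ := Finset.card_pos.1 (Nat.pos_of_ne_zero h)
      rw [Finset.card_eq_zero]
      ext w
      simp only [Finset.mem_filter, Finset.mem_univ, true_and, Finset.notMem_empty, iff_false]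
      intro h
      obtain ⟨i, _⟩ := h a ha
      exact i.elim0
  | succ n ih =>
    have key : (Finset.univ.filter fun w : Fin (n + 1) → Fin K => ∀ a ∈ A, ∃ i, w i = a).card =
        ∑ a : Fin K, wordCount K n (A.erase a).card := by
      simp only [← ih]
      rw [← Finset.card_sigma]
      refine Finset.card_bij' (fun w _ => ⟨w 0, Fin.tail w⟩) (fun p _ => Fin.cons p.1 p.2)
        ?_ ?_ ?_ ?_
      · intro w hw
        simp only [Finset.mem_filter, Finset.mem_univ, true_and, Finset.mem_sigma,
          Finset.mem_erase] at hw ⊢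
        rintro a ⟨h1, h2⟩
        obtain ⟨i, hi⟩ := hw a h2
        cases i using Fin.cases with
        | zero => exact absurd hi.symm h1
        | succ i => exact ⟨i, hi⟩
      · rintro ⟨b, w⟩ hw
        simp only [Finset.mem_filter, Finset.mem_univ, true_and, Finset.mem_sigma,
          Finset.mem_erase] at hw ⊢
        intro a ha
        by_cases hab : a = b
        · exact ⟨0, by simp [hab]⟩
        · obtain ⟨i, hi⟩ := hw a ⟨hab, ha⟩
          exact ⟨i.succ, by simpa using hi⟩
      · intro w _
        simp
      · rintro ⟨b, w⟩ _
        simp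
    rw [key, ← Finset.sum_add_sum_compl A, Finset.sum_congr rfl
      (fun a ha => by rw [Finset.card_erase_of_mem ha] : ∀ a ∈ A, _ = wordCount K n (A.card - 1)),
      Finset.sum_congr rfl (fun a ha => by rw [Finset.erase_eq_of_notMem (Finset.mem_compl.1 ha)] :
        ∀ a ∈ Aᶜ, _ = wordCount K n A.card)]
    simp only [Finset.sum_const, Finset.card_compl, Fintype.card_fin, smul_eq_mul, wordCount]
    ring

theorem card_fubiniWord (n k : ℕ) : Nat.card (FubiniWord n k) = wordCount k n k := by
  have := card_words_containing k n Finset.univ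
  rw [Finset.card_univ, Fintype.card_fin] at this
  rw [← this, Nat.card_eq_fintype_card, Fintype.card_subtype]
  congr 1
  ext w
  rw [Finset.mem_filter, Finset.mem_filter]
  simp [Function.Surjective]

theorem card_filter_cons {n k : ℕ} (P : Fin k → (Fin n → Fin k) → Prop)
    [∀ a w, Decidable (P a w)] :
    (Finset.univ.filter fun w : Fin (n + 1) → Fin k => P (w 0) (Fin.tail w)).card =
      ∑ w : Fin n → Fin k, (Finset.univ.filter fun a => P a w).card := by
  rw [← Finset.card_sigma]
  refine Finset.card_bij' (fun w _ => ⟨Fin.tail w, w 0⟩) (fun p _ => Fin.cons p.2 p.1) ?_ ?_ ?_ ?_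
  · intro w hw
    simpa using hw
  · rintro ⟨w, b⟩ hw
    simpa using hw
  · intro w _
    simp
  · rintro ⟨w, b⟩ _
    simp

theorem card_filter_val_le {k m : ℕ} (hm : m < k) :
    (Finset.univ.filter fun a : Fin k => (a : ℕ) ≤ m).card = m + 1 := by
  have : (Finset.univ.filter fun a : Fin k => (a : ℕ) ≤ m) = Finset.Iic ⟨m, hm⟩ := by
    ext a
    simp [Fin.le_def]
  rw [this, Fin.card_Iic]

theorem card_filter_lt_val {k m : ℕ} (hm : m < k) :
    (Finset.univ.filter fun a : Fin k => ¬ (a : ℕ) ≤ m).card = k - 1 - m := by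
  have := Finset.card_filter_add_card_filter_not (s := Finset.univ) fun a : Fin k => (a : ℕ) ≤ m
  rw [card_filter_val_le hm, Finset.card_univ, Fintype.card_fin] at this
  omega

/-- Prepending a letter keeps the counter at `m` for the `k - 1 - m` letters above `m`, and moves it
from `m - 1` to `m` for the `m` letters at most `m - 1`. This is the recurrence of `wordCount (k -
1)`. -/
theorem card_greedy_eq (n k m : ℕ) (hm : m < k) :
    (Finset.univ.filter fun w : Fin n → Fin k => greedy n (fun i => (w i : ℕ)) = m).card =
      wordCount (k - 1) n m := by
  induction n generalizing m with
  | zero =>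
    rw [wordCount]
    by_cases h : m = 0
    · simp [h, greedy]
    · simp [h, greedy, Ne.symm h]
  | succ n ih =>
    have e := card_filter_cons (n := n) (k := k) fun a w =>
      greedy n (fun i => (w i : ℕ)) + (if (a : ℕ) ≤ greedy n (fun i => (w i : ℕ)) then 1 else 0) = m
    change (Finset.univ.filter fun w : Fin (n + 1) → Fin k =>
      greedy (n + 1) (fun i => (w i : ℕ)) = m).card = _ at e
    have e2 : ∀ w : Fin n → Fin k, (Finset.univ.filter fun a : Fin k =>
        greedy n (fun i => (w i : ℕ)) +
          (if (a : ℕ) ≤ greedy n (fun i => (w i : ℕ)) then 1 else 0) = m).card =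
        (if greedy n (fun i => (w i : ℕ)) = m then k - 1 - m else 0) +
        (if greedy n (fun i => (w i : ℕ)) + 1 = m then m else 0) := by
      intro w
      generalize greedy n (fun i => (w i : ℕ)) = g
      by_cases h1 : g = m
      · subst h1
        rw [if_pos rfl, if_neg (by omega), add_zero, ← card_filter_lt_val hm]
        congr 1
        ext a
        rw [Finset.mem_filter, Finset.mem_filter]
        simp
      · by_cases h2 : g + 1 = m
        · subst h2
          rw [if_neg h1, if_pos rfl, zero_add]
          refine Eq.trans ?_ (card_filter_val_le (by omega : g < k))
          congr 1
          ext a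
          simp
        · rw [if_neg h1, if_neg h2, Finset.card_eq_zero, Finset.filter_eq_empty_iff]
          intro a _
          split_ifs <;> omega
    rw [e, Finset.sum_congr rfl fun w _ => e2 w, Finset.sum_add_distrib, ← Finset.sum_filter,
      ← Finset.sum_filter, Finset.sum_const, Finset.sum_const, ih m hm, wordCount]
    cases m with
    | zero => simp [mul_comm]
    | succ m =>
      simp only [Nat.add_right_cancel_iff, Nat.add_sub_cancel, smul_eq_mul]
      rw [ih m (by omega)]
      ring

/-- Once the counter is at least `k - 1`, every letter is accepted. So the count for `n + 1` is `k`
times the sum of the counts for `k ≤ greedy` and `greedy = k - 1`, and `wordCount_succ_left` merges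
these two. -/
theorem card_le_greedy_words (n k : ℕ) (hk : 0 < k) :
    (Finset.univ.filter fun w : Fin n → Fin k => k ≤ greedy n (fun i => (w i : ℕ))).card =
      wordCount k n k := by
  induction n with
  | zero =>
    rw [wordCount, if_neg (by omega)]
    simp [greedy, hk.ne']
  | succ n ih =>
    have e := card_filter_cons (n := n) (k := k) fun a w =>
      k ≤ greedy n (fun i => (w i : ℕ)) + (if (a : ℕ) ≤ greedy n (fun i => (w i : ℕ)) then 1 else 0)
    change (Finset.univ.filter fun w : Fin (n + 1) → Fin k =>
      k ≤ greedy (n + 1) (fun i => (w i : ℕ))).card = _ at e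
    have e2 : ∀ w : Fin n → Fin k, (Finset.univ.filter fun a : Fin k =>
        k ≤ greedy n (fun i => (w i : ℕ)) +
          (if (a : ℕ) ≤ greedy n (fun i => (w i : ℕ)) then 1 else 0)).card =
        (if k ≤ greedy n (fun i => (w i : ℕ)) then k else 0) +
        (if greedy n (fun i => (w i : ℕ)) = k - 1 then k else 0) := by
      intro w
      generalize greedy n (fun i => (w i : ℕ)) = g
      by_cases h1 : k ≤ g
      · rw [if_pos h1, if_neg (by omega), add_zero, Finset.filter_true_of_mem (by intros; omega),
          Finset.card_univ, Fintype.card_fin]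
      · by_cases h2 : g = k - 1
        · rw [if_neg h1, if_pos h2, zero_add, Finset.filter_true_of_mem, Finset.card_univ,
            Fintype.card_fin]
          intro a _
          have := a.2
          rw [if_pos (by omega)]
          omega
        · rw [if_neg h1, if_neg h2, Finset.card_eq_zero, Finset.filter_eq_empty_iff]
          intro a _
          split_ifs <;> omega
    rw [e, Finset.sum_congr rfl fun w _ => e2 w, Finset.sum_add_distrib, ← Finset.sum_filter,
      ← Finset.sum_filter, Finset.sum_const, Finset.sum_const, ih,
      card_greedy_eq n k (k - 1) (by omega), wordCount]
    obtain ⟨l, rfl⟩ := Nat.exists_eq_add_of_le' hk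
    have := wordCount_succ_left l n l le_rfl
    simp only [Nat.add_sub_cancel, smul_eq_mul, Nat.sub_self] at *
    rw [this]
    ring

/-- There are as many `(n,k)`-substaircase sequences as Fubini words. -/
theorem card_isSubstaircase (n k : ℕ) (hk : 0 < k) :
    Nat.card {a : Fin n →₀ ℕ // IsSubstaircase n k a} = Nat.card (FubiniWord n k) := by
  rw [card_fubiniWord, ← card_le_greedy_words n k hk, ← Fintype.card_subtype,
    ← Nat.card_eq_fintype_card]
  refine Nat.card_congr
    { toFun := fun a => ⟨fun i => ⟨a.1 i, ((isSubstaircase_iff hk _).1 a.2).1 i⟩,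
        ((isSubstaircase_iff hk _).1 a.2).2⟩
      invFun := fun w => ⟨Finsupp.equivFunOnFinite.symm fun i => (w.1 i : ℕ),
        (isSubstaircase_iff hk _).2 ⟨fun i => (w.1 i).2, w.2⟩⟩
      left_inv := fun a => by
        apply Subtype.ext
        ext i
        rfl
      right_inv := fun w => by
        apply Subtype.ext
        ext i
        rfl }

theorem finite_isSubstaircase (n k : ℕ) (hk : 0 < k) :
    Finite {a : Fin n →₀ ℕ // IsSubstaircase n k a} := by
  refine Finite.of_injective
    (fun a i => (⟨a.1 i, ((isSubstaircase_iff hk _).1 a.2).1 i⟩ : Fin k)) ?_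
  intro a b h
  apply Subtype.ext
  ext i
  exact congrArg Fin.val (congrFun h i)

/-- A sequence with entries below `k` which is above no reversed skip sequence of size `n - k + 1`
is `(n,k)`-substaircase. -/
theorem isSubstaircase_of_nonskip {n k : ℕ} (hk : 0 < k) (hkn : k ≤ n) (c : Fin n → ℕ)
    (hc : ∀ i, c i < k)
    (hS : ∀ S : Finset (Fin n), S.card = n - k + 1 → ¬ ∀ i, skip S i.rev ≤ c i) :
    IsSubstaircase n k c := by
  rw [isSubstaircase_iff hk]
  refine ⟨hc, ?_⟩
  by_contra hlt
  obtain ⟨S, hcard, h⟩ := exists_skip_le n c (n - k + 1) (by omega)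
  refine hS (S.map Fin.revPerm.toEmbedding) (by simpa using hcard) fun i => ?_
  rw [skip]
  split_ifs with hi
  · have hi' : i ∈ S := by simpa using hi
    have h1 := h i hi'
    have : ((S.map Fin.revPerm.toEmbedding).filter (· < i.rev)).card =
        (S.filter (i < ·)).card := by
      rw [Finset.filter_map, Finset.card_map]
      congr 1
      ext j
      simp
    rw [this, Fin.val_rev]
    omega
  · exact Nat.zero_le _

end OrbitHarmonics

noncomputable section
namespace OrbitHarmonics
open MvPolynomial

/-! ### Geometric series and elementary symmetric functions -/

section Series

variable {R : Type*} [CommRing R]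

/-- The power series `1 / (1 - a t)`. -/
def geo (a : R) : PowerSeries R := PowerSeries.mk fun d => a ^ d

theorem coeff_geo (a : R) (d : ℕ) : PowerSeries.coeff d (geo a) = a ^ d := PowerSeries.coeff_mk _ _

theorem geo_mul (a : R) : geo a * (1 - PowerSeries.C a * PowerSeries.X) = 1 := by
  ext d
  cases d with
  | zero => simp [mul_sub, geo]
  | succ d =>
    rw [mul_sub, mul_one, ← mul_assoc, map_sub, PowerSeries.coeff_succ_mul_X,
      mul_comm (geo a), PowerSeries.coeff_C_mul, coeff_geo, coeff_geo, PowerSeries.coeff_one]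
    simp [pow_succ']

theorem map_geo {S : Type*} [CommRing S] (f : R →+* S) (a : R) :
    PowerSeries.map f (geo a) = geo (f a) := by
  ext d
  simp [geo]

theorem geo_mul_geo (a b : R) :
    (PowerSeries.C a - PowerSeries.C b) * (geo a * geo b) =
      PowerSeries.C a * geo a - PowerSeries.C b * geo b := by
  linear_combination (PowerSeries.C a * geo a) * geo_mul b - (PowerSeries.C b * geo b) * geo_mul a

theorem prod_geo_mul {ι : Type*} (s : Finset ι) (a : ι → R) :
    (∏ i ∈ s, geo (a i)) * ∏ i ∈ s, (1 - PowerSeries.C (a i) * PowerSeries.X) = 1 := by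
  rw [← Finset.prod_mul_distrib]
  exact Finset.prod_eq_one fun i _ => geo_mul (a i)

theorem coeff_prod_one_sub {ι : Type*} (s : Finset ι) (a : ι → R) (r : ℕ) :
    PowerSeries.coeff r (∏ i ∈ s, (1 - PowerSeries.C (a i) * PowerSeries.X)) =
      (-1) ^ r * ∑ t ∈ s.powersetCard r, ∏ i ∈ t, a i := by
  classical
  simp only [sub_eq_add_neg]
  rw [Finset.prod_one_add, map_sum]
  have h : ∀ t : Finset ι, PowerSeries.coeff r (∏ i ∈ t, -(PowerSeries.C (a i) * PowerSeries.X)) =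
      if t.card = r then (-1) ^ r * ∏ i ∈ t, a i else 0 := by
    intro t
    have : ∏ i ∈ t, -(PowerSeries.C (a i) * PowerSeries.X) =
        PowerSeries.C ((-1) ^ t.card * ∏ i ∈ t, a i) * PowerSeries.X ^ t.card := by
      rw [Finset.prod_neg, Finset.prod_mul_distrib, Finset.prod_const, map_mul, map_prod, map_pow,
        map_neg, map_one, mul_assoc]
    rw [this, PowerSeries.coeff_C_mul, PowerSeries.coeff_X_pow]
    split_ifs with h1 h2 h2
    · rw [← h1]; simp
    · exact absurd h1.symm h2
    · exact absurd h2.symm h1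
    · simp
  simp only [h]
  rw [← Finset.sum_filter, Finset.mul_sum]
  refine Finset.sum_congr ?_ fun _ _ => rfl
  ext t
  simp [Finset.mem_powersetCard]

theorem coeff_prod_one_sub_of_lt {ι : Type*} (s : Finset ι) (a : ι → R) {r : ℕ}
    (h : s.card < r) :
    PowerSeries.coeff r (∏ i ∈ s, (1 - PowerSeries.C (a i) * PowerSeries.X)) = 0 := by
  rw [coeff_prod_one_sub, Finset.powersetCard_eq_empty.2 h, Finset.sum_empty, mul_zero]

/-- A product of power series written as a matrix–vector product. The factor `X ^ a` shifts the
index of `E` to `j - a`, giving 0 when this is negative, and the vanishing of `E` beyond `j` makes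
finitely many columns suffice. -/
theorem coeff_mul_eq_sum_fin (F E : PowerSeries R) (d : ℕ) {r j : ℕ} (hj : j < r)
    (hE : ∀ v, j < v → PowerSeries.coeff v E = 0) :
    ∑ a : Fin r, PowerSeries.coeff (d + a) F *
        PowerSeries.coeff j (PowerSeries.X ^ (a : ℕ) * E) =
      PowerSeries.coeff (d + j) (F * E) := by
  rw [Fin.sum_univ_eq_sum_range (fun a => PowerSeries.coeff (d + a) F *
        PowerSeries.coeff j (PowerSeries.X ^ a * E)) r, mul_comm F E, PowerSeries.coeff_mul,
    Finset.Nat.sum_antidiagonal_eq_sum_range_succ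
      (fun u v => PowerSeries.coeff u E * PowerSeries.coeff v F)]
  rw [← Finset.sum_subset (Finset.range_mono (by omega : j + 1 ≤ r)),
    ← Finset.sum_subset (Finset.range_mono (by omega : j + 1 ≤ d + j + 1)),
    ← Finset.sum_range_reflect]
  · refine Finset.sum_congr rfl fun a ha => ?_
    have := Finset.mem_range.1 ha
    rw [PowerSeries.coeff_X_pow_mul', if_pos (by omega), mul_comm]
    congr 3 <;> omega
  · intro v _ hv
    rw [hE v (by simpa using hv), zero_mul]
  · intro a _ ha
    rw [PowerSeries.coeff_X_pow_mul', if_neg (by simpa using ha), mul_zero]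

end Series

/-! ### Flagged Schur functions and Demazure characters -/

/-- `∏_{l ≤ m} 1 / (1 - x_l t)`, the generating function of the complete homogeneous symmetric
polynomials in the variables up to `x_m`. -/
def flagSeries {n : ℕ} (m : Fin n) : PowerSeries (MvPolynomial (Fin n) ℂ) :=
  ∏ l ∈ Finset.Iic m, geo (X l)

/-- The Jacobi–Trudi matrix of the flagged Schur function of shape `lam` with flag `p`. -/
def flaggedMatrix {n r : ℕ} (p : Fin r → Fin n) (lam : Fin r → ℕ) :
    Matrix (Fin r) (Fin r) (MvPolynomial (Fin n) ℂ) :=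
  Matrix.of fun i j =>
    PowerSeries.coeff (lam i + j) (PowerSeries.X ^ (i : ℕ) * flagSeries (p i))

/-- The entry is $h_{\lambda_i+j-i}(x_l : l\le p_i)$; the factor `X ^ i` makes it 0 for a negative
index without truncated subtraction. -/
theorem flaggedMatrix_apply {n r : ℕ} (p : Fin r → Fin n) (lam : Fin r → ℕ) (i j : Fin r) :
    flaggedMatrix p lam i j =
      PowerSeries.coeff (lam i + j) (PowerSeries.X ^ (i : ℕ) * flagSeries (p i)) := rfl

/-- The flagged Schur function with the tight flag is a monomial. -/
theorem det_flaggedMatrix_tight {n r : ℕ} (p : Fin r → Fin n) (lam : Fin r → ℕ)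
    (hp : ∀ i, (p i : ℕ) = i) (hlam : ∀ i, 0 < lam i) :
    (flaggedMatrix p lam).det = ∏ i, X (p i) ^ lam i := by
  -- Multiply by the unitriangular matrix of signed elementary symmetric polynomials in the
  -- variables before `p j`. In row `i` and column `j` the two products then cancel: on the diagonal
  -- $1/(1-x_{p_i}t)$ remains, and above it a polynomial in $t$ of degree $j-i-1$, too small to
  -- contribute.
  obtain ⟨E, hE⟩ : ∃ E : Fin r → PowerSeries (MvPolynomial (Fin n) ℂ), ∀ j, E j =
    ∏ l ∈ Finset.Iio (p j), (1 - PowerSeries.C (X l) * PowerSeries.X) := ⟨_, fun _ => rfl⟩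
  obtain ⟨U, hUE⟩ : ∃ U : Matrix (Fin r) (Fin r) (MvPolynomial (Fin n) ℂ), ∀ a j,
    U a j = PowerSeries.coeff (j : ℕ) (PowerSeries.X ^ (a : ℕ) * E j) :=
      ⟨Matrix.of _, fun _ _ => rfl⟩
  have hU : U.det = 1 := by
    rw [Matrix.det_of_isUpperTriangular]
    · refine Finset.prod_eq_one fun i _ => ?_
      rw [hUE, hE, PowerSeries.coeff_X_pow_mul', if_pos le_rfl, Nat.sub_self, coeff_prod_one_sub]
      simp
    · intro a j haj
      have : (j : ℕ) < a := haj
      rw [hUE, PowerSeries.coeff_X_pow_mul', if_neg (by omega)]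
  have hM : ∀ i j, (flaggedMatrix p lam * U) i j =
      PowerSeries.coeff (lam i + j) (PowerSeries.X ^ (i : ℕ) * flagSeries (p i) * E j) := by
    intro i j
    simp only [Matrix.mul_apply, flaggedMatrix_apply, hUE]
    refine coeff_mul_eq_sum_fin _ _ _ j.2 fun v hv => ?_
    rw [hE]
    refine coeff_prod_one_sub_of_lt _ _ ?_
    rw [Fin.card_Iio, hp]
    exact hv
  rw [← mul_one (flaggedMatrix p lam).det, ← hU, ← Matrix.det_mul, Matrix.det_of_isLowerTriangular]
  · refine Finset.prod_congr rfl fun i _ => ?_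
    have : flagSeries (p i) * E i = geo (X (p i)) := by
      rw [hE, flagSeries, ← Finset.Iio_insert, Finset.prod_insert (by simp), mul_assoc,
        prod_geo_mul, mul_one]
    rw [hM, mul_assoc, this, PowerSeries.coeff_X_pow_mul', if_pos (by omega), coeff_geo]
    congr 1
    omega
  · intro i j hij
    have hij : i < j := hij
    have hij' : (i : ℕ) < j := hij
    have : flagSeries (p i) * E j =
        ∏ l ∈ Finset.Ioo (p i) (p j), (1 - PowerSeries.C (X l) * PowerSeries.X) := by
      have hd : Finset.Iio (p j) = (Finset.Iic (p i)).disjUnion (Finset.Ioo (p i) (p j)) (by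
          rw [Finset.disjoint_left]
          intro l h1 h2
          exact absurd (Finset.mem_Iic.1 h1) (not_le.2 (Finset.mem_Ioo.1 h2).1)) := by
        ext l
        have h1 := hp i
        have h2 := hp j
        simp only [Finset.mem_Iio, Finset.disjUnion_eq_union, Finset.mem_union, Finset.mem_Iic,
          Finset.mem_Ioo, Fin.lt_def, Fin.le_def]
        omega
      rw [hE, hd, Finset.prod_disjUnion, flagSeries, ← mul_assoc, prod_geo_mul, one_mul]
    rw [hM, mul_assoc, this, PowerSeries.coeff_X_pow_mul', if_pos (by omega),
      coeff_prod_one_sub_of_lt]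
    rw [Fin.card_Ioo, hp, hp]
    have := hlam i
    omega

theorem map_swap_prod_geo {n : ℕ} (s : Finset (Fin n)) (q m : Fin n) (h : q ∈ s ↔ m ∈ s) :
    PowerSeries.map (rename (Equiv.swap q m) : MvPolynomial (Fin n) ℂ →ₐ[ℂ] _).toRingHom
      (∏ l ∈ s, geo (X l)) = ∏ l ∈ s, geo (X l) := by
  rw [map_prod]
  refine Finset.prod_bij' (fun l _ => Equiv.swap q m l) (fun l _ => Equiv.swap q m l)
    ?_ ?_ ?_ ?_ ?_
  · intro l hl
    rw [Equiv.swap_apply_def]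
    grind
  · intro l hl
    rw [Equiv.swap_apply_def]
    grind
  · simp
  · simp
  · intro l _
    rw [map_geo]
    simp

/-- Moving a row of the flag from `q` to `q + 1` applies the isobaric divided difference. -/
theorem isobaric_det_flaggedMatrix {n r : ℕ} (p : Fin r → Fin n) (lam : Fin r → ℕ)
    (hp : Function.Injective p) (i : Fin r) (q : Fin n) (hq : (q : ℕ) + 1 = p i)
    (hqp : ∀ j, p j ≠ q) :
    isobaric q (p i) (flaggedMatrix (Function.update p i q) lam).det =
      (flaggedMatrix p lam).det := by
  have hne : q ≠ p i := fun h => hqp i h.symm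
  set m := p i with hm
  set φ : MvPolynomial (Fin n) ℂ →+* MvPolynomial (Fin n) ℂ :=
    (rename (Equiv.swap q m) : MvPolynomial (Fin n) ℂ →ₐ[ℂ] _).toRingHom with hφ
  set M := flaggedMatrix (Function.update p i q) lam with hMdef
  refine mul_left_cancel₀ (X_sub_X_ne_zero hne) ?_
  rw [isobaric_spec]
  have hrow : ∀ j, j ≠ i → M j = flaggedMatrix p lam j := by
    intro j hj
    funext l
    rw [hMdef, flaggedMatrix_apply, flaggedMatrix_apply, Function.update_of_ne hj]
  have h1 : flaggedMatrix p lam = M.updateRow i (flaggedMatrix p lam i) := by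
    funext j
    by_cases hj : j = i
    · subst hj; simp
    · rw [Matrix.updateRow_ne hj, hrow j hj]
  -- The flag of any other row contains both `q` and `m` or neither, so the swap changes row `i`
  -- only and the divided difference acts on that row alone.
  have h2 : φ.mapMatrix M = M.updateRow i (fun l => φ (M i l)) := by
    funext j
    by_cases hj : j = i
    · subst hj
      rw [Matrix.updateRow_self]
      rfl
    · rw [Matrix.updateRow_ne hj]
      funext l
      change φ (M j l) = M j l
      rw [hrow j hj, flaggedMatrix_apply, ← PowerSeries.coeff_map, map_mul, map_pow,
        PowerSeries.map_X, flagSeries, hφ, map_swap_prod_geo]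
      have h3 : (p j : ℕ) ≠ q := fun h => hqp j (Fin.ext h)
      have h4 : (p j : ℕ) ≠ m := fun h => hj (hp (Fin.ext h))
      simp only [Finset.mem_Iic, Fin.le_def]
      omega
  -- The row identity in generating function form: the isobaric divided difference adjoins the
  -- variable `X m` to the complete symmetric polynomials.
  have hser : (PowerSeries.C (X q) - PowerSeries.C (X m)) * flagSeries m =
      PowerSeries.C (X q) * flagSeries q -
        PowerSeries.C (X m) * PowerSeries.map φ (flagSeries q) := by
    have e1 : flagSeries q = geo (X q) * ∏ l ∈ Finset.Iio q, geo (X l) := by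
      rw [flagSeries, ← Finset.Iio_insert, Finset.prod_insert (by simp)]
    have e2 : flagSeries m = geo (X m) * flagSeries q := by
      rw [flagSeries, flagSeries, ← Finset.Iio_insert, Finset.prod_insert (by simp)]
      congr 2
      ext l
      simp only [Finset.mem_Iio, Finset.mem_Iic, Fin.lt_def, Fin.le_def]
      omega
    have e3 : PowerSeries.map φ (flagSeries q) = geo (X m) * ∏ l ∈ Finset.Iio q, geo (X l) := by
      rw [e1, map_mul, map_geo, hφ, map_swap_prod_geo]
      · simp
      · simp only [Finset.mem_Iio, Fin.lt_def]
        omega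
    rw [e3, e2, e1]
    linear_combination (∏ l ∈ Finset.Iio q, geo (X l)) *
      geo_mul_geo (X q : MvPolynomial (Fin n) ℂ) (X m)
  have h5 : (X q - X m : MvPolynomial (Fin n) ℂ) • flaggedMatrix p lam i =
      (X q : MvPolynomial (Fin n) ℂ) • M i + (-X m : MvPolynomial (Fin n) ℂ) •
        (fun l => φ (M i l)) := by
    funext l
    simp only [Pi.smul_apply, Pi.add_apply, smul_eq_mul]
    rw [hMdef, flaggedMatrix_apply, flaggedMatrix_apply, Function.update_self, ← hm,
      ← PowerSeries.coeff_map, map_mul (PowerSeries.map φ), map_pow, PowerSeries.map_X,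
      ← PowerSeries.coeff_C_mul,
      ← PowerSeries.coeff_C_mul, ← PowerSeries.coeff_C_mul, ← map_add]
    congr 1
    rw [map_sub, map_neg]
    linear_combination (PowerSeries.X ^ (i : ℕ)) * hser
  have h6 : rename (Equiv.swap q m) M.det = (M.updateRow i (fun l => φ (M i l))).det := by
    rw [← h2, ← RingHom.map_det]
    rfl
  have h7 : (X q - X m : MvPolynomial (Fin n) ℂ) * (M.updateRow i (flaggedMatrix p lam i)).det =
      X q * (M.updateRow i (M i)).det + -X m * (M.updateRow i (fun l => φ (M i l))).det := by
    rw [← Matrix.det_updateRow_smul M i (X q - X m), h5, Matrix.det_updateRow_add,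
      Matrix.det_updateRow_smul, Matrix.det_updateRow_smul]
  rw [h6, h1, h7, Matrix.updateRow_eq_self]
  ring

/-- The Demazure character of a composition whose nonzero entries are weakly decreasing is a
flagged Schur function. -/
theorem demazure_eq_det {n r : ℕ} (p : Fin r → Fin n) (lam : Fin r → ℕ) (hp : StrictMono p)
    (hlam : Antitone lam) (hpos : ∀ i, 0 < lam i) (δ : Fin n → ℕ) (h1 : ∀ i, δ (p i) = lam i)
    (h0 : ∀ l, (∀ i, p i ≠ l) → δ l = 0) :
    demazure δ = (flaggedMatrix p lam).det := by
  induction hw : weight δ using Nat.strong_induction_on generalizing p δ with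
  | _ w ih =>
  subst hw
  -- If the position before some `p i` is free, `δ` ascends there from 0 to `lam i`; swapping lowers
  -- the weight and moves the flag of that row back by one. With no such gap the flag is an initial
  -- segment and `δ` is weakly decreasing.
  by_cases hex : ∃ i, ∃ q : Fin n, (q : ℕ) + 1 = p i ∧ ∀ j, p j ≠ q
  · obtain ⟨i, q, hq, hqp⟩ := hex
    have hlt : δ q < δ (p i) := by
      rw [h0 q hqp, h1]
      exact hpos i
    have hne : ∀ j, j ≠ i → p j ≠ p i := fun j hj h => hj (hp.injective h)
    rw [demazure_of_ascent δ q (p i) hq hlt,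
      ih _ (weight_swap_lt hq hlt) (Function.update p i q) ?_ (δ ∘ Equiv.swap q (p i)) ?_ ?_ rfl,
      isobaric_det_flaggedMatrix p lam hp.injective i q hq hqp]
    · intro a b hab
      have hab' := hp hab
      have ha := hqp a
      have hb := hqp b
      simp only [Function.update_apply]
      split_ifs with e1 e2 e2
      · exact absurd (e1.trans e2.symm) hab.ne
      · subst e1
        simp only [Fin.lt_def] at *
        omega
      · subst e2
        simp only [Fin.lt_def, ne_eq, Fin.ext_iff] at *
        omega
      · exact hab'
    · intro j
      by_cases hj : j = i
      · subst hj
        simp [h1]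
      · rw [Function.update_of_ne hj, Function.comp_apply,
          Equiv.swap_apply_of_ne_of_ne (hqp j) (hne j hj), h1]
    · intro l hl
      have hlq : l ≠ q := fun e => hl i (by rw [Function.update_self, e])
      by_cases hli : l = p i
      · rw [Function.comp_apply, hli, Equiv.swap_apply_right]
        exact h0 q hqp
      · rw [Function.comp_apply, Equiv.swap_apply_of_ne_of_ne hlq hli]
        refine h0 l fun j hj => ?_
        by_cases hji : j = i
        · exact hli (by rw [← hj, hji])
        · exact hl j (by rw [Function.update_of_ne hji, hj])
  · push Not at hex
    have hpi : ∀ v, ∀ i, (p i : ℕ) = v → (i : ℕ) = v := by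
      intro v
      induction v with
      | zero =>
        intro i hi
        by_contra hne
        have : p ⟨0, by omega⟩ < p i := hp (Fin.lt_def.2 (Nat.pos_of_ne_zero hne))
        simp only [Fin.lt_def] at this
        omega
      | succ v ihv =>
        intro i hi
        obtain ⟨j, hj⟩ := hex i ⟨v, by omega⟩ hi.symm
        have hjv : (p j : ℕ) = v := congrArg Fin.val hj
        have hj' := ihv j hjv
        have hji : j < i := by
          rw [← hp.lt_iff_lt, Fin.lt_def]
          omega
        rw [Fin.lt_def] at hji
        by_contra hne
        have a1 : p j < p ⟨j + 1, by omega⟩ := hp (Fin.lt_def.2 (Nat.lt_succ_self _))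
        have a2 : p ⟨j + 1, by omega⟩ < p i := hp (Fin.lt_def.2 (by simp only; omega))
        rw [Fin.lt_def] at a1 a2
        omega
    have hpi' : ∀ i, (p i : ℕ) = i := fun i => (hpi _ i rfl).symm
    rw [det_flaggedMatrix_tight p lam hpi' hpos, demazure_of_antitone]
    · symm
      refine Fintype.prod_of_injective p hp.injective _ _ ?_ ?_
      · intro l hl
        rw [h0 l (by simpa using hl), pow_zero]
      · intro i
        rw [h1]
    · intro a b hab
      by_cases hb : ∃ j, p j = b
      · obtain ⟨j, rfl⟩ := hb
        have := hpi' j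
        rw [Fin.le_def] at hab
        have ha : p ⟨a, by omega⟩ = a := Fin.ext (hpi' _)
        rw [← ha, h1, h1]
        exact hlam (Fin.le_def.2 (by simp only; omega))
      · push Not at hb
        rw [h0 b hb]
        exact Nat.zero_le _

/-! ### The initial monomial of a flagged Schur function -/

open scoped MonomialOrder

theorem neglex_single_le {n : ℕ} {l m : Fin n} (h : l ≤ m) (d : ℕ) :
    Finsupp.single l d ≼[neglex n] Finsupp.single m d := by
  obtain rfl | h := h.eq_or_lt
  · exact le_rfl
  obtain rfl | hd := Nat.eq_zero_or_pos d
  · simp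
  refine le_of_lt ((neglex_lt_iff _ _).2 ⟨m, ?_, ?_⟩)
  · simpa [Finsupp.single_apply, h.ne] using hd
  · intro j hj
    simp [(h.trans hj).ne, hj.ne]

theorem degree_coeff_prod_geo_le {n : ℕ} (s : Finset (Fin n)) (m : Fin n) (hs : ∀ l ∈ s, l ≤ m)
    (d : ℕ) :
    (neglex n).degree (PowerSeries.coeff d (∏ l ∈ s, geo (X l : MvPolynomial (Fin n) ℂ)))
      ≼[neglex n] Finsupp.single m d := by
  classical
  induction s using Finset.induction_on generalizing d with
  | empty =>
    rw [Finset.prod_empty, PowerSeries.coeff_one]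
    split_ifs
    · rw [MonomialOrder.degree_one]; simp [(neglex n).zero_le]
    · rw [MonomialOrder.degree_zero]; simp [(neglex n).zero_le]
  | insert a s ha ih =>
    rw [Finset.prod_insert ha, PowerSeries.coeff_mul]
    refine (MonomialOrder.degree_sum_le).trans (Finset.sup_le ?_)
    rintro ⟨u, v⟩ huv
    replace huv : u + v = d := Finset.HasAntidiagonal.mem_antidiagonal.1 huv
    dsimp only
    rw [coeff_geo]
    refine MonomialOrder.degree_mul_le.trans ?_
    rw [← huv, Finsupp.single_add, map_add, map_add]
    refine add_le_add ?_ (ih (fun l hl => hs l (Finset.mem_insert_of_mem hl)) v)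
    have : (neglex n).degree ((X a : MvPolynomial (Fin n) ℂ) ^ u) = Finsupp.single a u := by
      rw [MonomialOrder.degree_pow, MonomialOrder.degree_X]
      simp
    rw [this]
    exact neglex_single_le (hs a (Finset.mem_insert_self _ _)) u

/-- Induction on `d` through $h_{d+1}(x_{\le m}) = x_m h_d(x_{\le m}) + h_{d+1}(x_{<m})$: the last
term does not involve $x_m$, so it is smaller in neglex. -/
theorem monic_coeff_flagSeries {n : ℕ} (m : Fin n) (d : ℕ) :
    (neglex n).Monic (PowerSeries.coeff d (flagSeries m)) ∧
      (neglex n).degree (PowerSeries.coeff d (flagSeries m)) = Finsupp.single m d := by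
  have hrec : flagSeries m = geo (X m) * ∏ l ∈ Finset.Iio m, geo (X l) := by
    rw [flagSeries, ← Finset.Iio_insert, Finset.prod_insert (by simp)]
  induction d with
  | zero =>
    have : PowerSeries.coeff 0 (flagSeries m) = 1 := by
      rw [flagSeries, PowerSeries.coeff_zero_eq_constantCoeff_apply, map_prod]
      refine Finset.prod_eq_one fun l _ => ?_
      rw [← PowerSeries.coeff_zero_eq_constantCoeff_apply, coeff_geo, pow_zero]
    rw [this]
    exact ⟨MonomialOrder.monic_one, by simp⟩
  | succ d ih =>
    obtain ⟨ih1, ih2⟩ := ih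
    set F := ∏ l ∈ Finset.Iio m, geo (X l : MvPolynomial (Fin n) ℂ) with hF
    have e1 : PowerSeries.coeff (d + 1) (flagSeries m) =
        X m * PowerSeries.coeff d (flagSeries m) + PowerSeries.coeff (d + 1) F := by
      have : flagSeries m = PowerSeries.C (X m) * (flagSeries m * PowerSeries.X) + F := by
        rw [hrec]
        linear_combination F * geo_mul (X m : MvPolynomial (Fin n) ℂ)
      conv_lhs => rw [this]
      rw [map_add, PowerSeries.coeff_C_mul, PowerSeries.coeff_succ_mul_X]
    have e2 : (neglex n).Monic (X m * PowerSeries.coeff d (flagSeries m)) :=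
      MonomialOrder.monic_X.mul ih1
    have e3 : (neglex n).degree (X m * PowerSeries.coeff d (flagSeries m)) =
        Finsupp.single m (d + 1) := by
      rw [MonomialOrder.degree_mul (X_ne_zero m) ih1.ne_zero, ih2, MonomialOrder.degree_X,
        ← Finsupp.single_add, add_comm]
    have e4 : (neglex n).degree (PowerSeries.coeff (d + 1) F) ≺[neglex n]
        (neglex n).degree (X m * PowerSeries.coeff d (flagSeries m)) := by
      rw [e3]
      by_cases hm : (m : ℕ) = 0
      · have : Finset.Iio m = ∅ := by
          ext l
          simp [Fin.lt_def, hm]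
        rw [hF, this, Finset.prod_empty, PowerSeries.coeff_one, if_neg (by omega),
          MonomialOrder.degree_zero, neglex_lt_iff]
        refine ⟨m, by simp, fun j hj => ?_⟩
        simp [hj.ne]
      · have hlt : (⟨m - 1, by omega⟩ : Fin n) < m := Fin.lt_def.2 (by simp only; omega)
        refine (degree_coeff_prod_geo_le _ ⟨m - 1, by omega⟩ ?_ _).trans_lt ?_
        · intro l hl
          simp only [Finset.mem_Iio, Fin.lt_def, Fin.le_def] at hl ⊢
          omega
        · rw [neglex_lt_iff]
          refine ⟨m, by simp [hlt.ne], fun j hj => ?_⟩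
          simp [hj.ne, (hlt.trans hj).ne]
    rw [e1]
    exact ⟨e2.add_of_lt e4, by rw [MonomialOrder.degree_add_of_lt e4, e3]⟩

theorem degree_flaggedMatrix_le {n r : ℕ} (p : Fin r → Fin n) (lam : Fin r → ℕ) (i j : Fin r) :
    (neglex n).degree (flaggedMatrix p lam i j) ≼[neglex n]
      Finsupp.single (p i) (lam i + j - i) := by
  rw [flaggedMatrix_apply, PowerSeries.coeff_X_pow_mul']
  split_ifs
  · rw [(monic_coeff_flagSeries _ _).2]
  · rw [MonomialOrder.degree_zero]; simp [(neglex n).zero_le]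

theorem flaggedMatrix_diag {n r : ℕ} (p : Fin r → Fin n) (lam : Fin r → ℕ) (i : Fin r) :
    flaggedMatrix p lam i i = PowerSeries.coeff (lam i) (flagSeries (p i)) := by
  rw [flaggedMatrix_apply, PowerSeries.coeff_X_pow_mul', if_pos (by omega), Nat.add_sub_cancel]

theorem sum_single_apply {n r : ℕ} {p : Fin r → Fin n} (hp : Function.Injective p)
    (f : Fin r → ℕ) (i : Fin r) : (∑ j, Finsupp.single (p j) (f j)) (p i) = f i := by
  rw [Finsupp.finsetSum_apply, Finset.sum_eq_single i]
  · simp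
  · intro j _ hj
    simp [hp.ne hj.symm]
  · simp

theorem sum_single_apply_of_forall_ne {n r : ℕ} {p : Fin r → Fin n} (f : Fin r → ℕ) {l : Fin n}
    (hl : ∀ i, p i ≠ l) : (∑ j, Finsupp.single (p j) (f j)) l = 0 := by
  rw [Finsupp.finsetSum_apply]
  exact Finset.sum_eq_zero fun j _ => by simp [(hl j).symm]

/-- In the Leibniz expansion the identity permutation dominates. The last index `i` moved by another
`σ` satisfies `σ i < i`, so the exponent of the variable `p i` drops while those of all later
variables agree. -/
theorem monic_det_flaggedMatrix {n r : ℕ} (hr : 0 < r) (p : Fin r → Fin n) (lam : Fin r → ℕ)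
    (hp : StrictMono p) (hpos : ∀ i, 0 < lam i) :
    (neglex n).Monic (flaggedMatrix p lam).det ∧
      (neglex n).degree (flaggedMatrix p lam).det = ∑ i, Finsupp.single (p i) (lam i) := by
  set M := flaggedMatrix p lam with hM
  have hd : (neglex n).Monic (∏ i, M i i) ∧
      (neglex n).degree (∏ i, M i i) = ∑ i, Finsupp.single (p i) (lam i) := by
    constructor
    · refine MonomialOrder.Monic.prod fun i _ => ?_
      rw [hM, flaggedMatrix_diag]
      exact (monic_coeff_flagSeries _ _).1
    · rw [MonomialOrder.degree_prod]
      · refine Finset.sum_congr rfl fun i _ => ?_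
        rw [hM, flaggedMatrix_diag, (monic_coeff_flagSeries _ _).2]
      · intro i _
        rw [hM, flaggedMatrix_diag]
        exact (monic_coeff_flagSeries _ _).1.ne_zero
  have hlt : ∀ σ : Equiv.Perm (Fin r), σ ≠ 1 →
      (neglex n).degree (Equiv.Perm.sign σ • ∏ i, M i (σ i)) ≺[neglex n]
        ∑ i, Finsupp.single (p i) (lam i) := by
    intro σ hσ
    have a1 : (neglex n).degree (Equiv.Perm.sign σ • ∏ i, M i (σ i)) =
        (neglex n).degree (∏ i, M i (σ i)) := by
      rcases Int.units_eq_one_or (Equiv.Perm.sign σ) with h | h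
      · rw [h, one_smul]
      · rw [h, Units.neg_smul, one_smul, MonomialOrder.degree_neg]
    rw [a1]
    have a2 : (neglex n).degree (∏ i, M i (σ i)) ≼[neglex n]
        ∑ i, Finsupp.single (p i) (lam i + σ i - i) := by
      refine MonomialOrder.degree_prod_le.trans ?_
      rw [map_sum, map_sum]
      exact Finset.sum_le_sum fun i _ => degree_flaggedMatrix_le p lam i (σ i)
    refine a2.trans_lt ?_
    obtain ⟨i, hi, hmax⟩ : ∃ i, σ i ≠ i ∧ ∀ j, i < j → σ j = j := by
      have hne : (Finset.univ.filter fun i => σ i ≠ i).Nonempty := by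
        by_contra h
        rw [Finset.not_nonempty_iff_eq_empty, Finset.filter_eq_empty_iff] at h
        exact hσ (Equiv.ext fun i => not_not.1 (h (Finset.mem_univ i)))
      refine ⟨Finset.max' _ hne, (Finset.mem_filter.1 (Finset.max'_mem _ hne)).2, fun j hj => ?_⟩
      by_contra h
      exact absurd (Finset.le_max' _ j (by simpa using h)) (not_le.2 hj)
    have hσi : σ i < i := by
      refine lt_of_le_of_ne (le_of_not_gt fun h => ?_) hi
      exact h.ne' (σ.injective (hmax _ h))
    rw [neglex_lt_iff]
    refine ⟨p i, ?_, fun l hl => ?_⟩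
    -- Positivity of `lam i` keeps the inequality strict even if the subtraction truncates.
    · rw [sum_single_apply hp.injective, sum_single_apply hp.injective]
      have := hpos i
      rw [Fin.lt_def] at hσi
      omega
    · by_cases hl' : ∃ j, p j = l
      · obtain ⟨j, rfl⟩ := hl'
        rw [sum_single_apply hp.injective, sum_single_apply hp.injective,
          hmax j (hp.lt_iff_lt.1 hl), Nat.add_sub_cancel]
      · push Not at hl'
        rw [sum_single_apply_of_forall_ne _ hl', sum_single_apply_of_forall_ne _ hl']
  have hsum : M.det = ∏ i, M i i +
      ∑ σ ∈ Finset.univ.erase (1 : Equiv.Perm (Fin r)), Equiv.Perm.sign σ • ∏ i, M i (σ i) := by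
    rw [← Matrix.det_transpose, Matrix.det_apply, ← Finset.add_sum_erase _ _ (Finset.mem_univ 1)]
    simp
  have hrest : (neglex n).degree (∑ σ ∈ Finset.univ.erase (1 : Equiv.Perm (Fin r)),
      Equiv.Perm.sign σ • ∏ i, M i (σ i)) ≺[neglex n] (neglex n).degree (∏ i, M i i) := by
    rw [hd.2]
    refine MonomialOrder.degree_sum_le.trans_lt ((Finset.sup_lt_iff ?_).2 ?_)
    -- A strict bound on a supremum over a possibly empty set needs a bound above `⊥`: the diagonal
    -- monomial is not 1, as `0 < r` and the parts are positive.
    · rw [bot_lt_iff_ne_bot, MonomialOrder.bot_eq_zero, ne_eq, EmbeddingLike.map_eq_zero_iff]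
      intro h
      have := DFunLike.congr_fun h (p ⟨0, hr⟩)
      rw [sum_single_apply hp.injective] at this
      exact (hpos _).ne' this
    · intro σ hσ
      exact hlt σ (Finset.ne_of_mem_erase hσ)
  rw [hsum]
  exact ⟨hd.1.add_of_lt hrest, by rw [MonomialOrder.degree_add_of_lt hrest, hd.2]⟩

/-! ### Membership in `I_{n,k}` -/

theorem coeff_prod_one_sub_X_mem {n k a : ℕ} (ha : n - k + 1 ≤ a) :
    PowerSeries.coeff a (∏ l : Fin n, (1 - PowerSeries.C (X l : MvPolynomial (Fin n) ℂ) *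
      PowerSeries.X)) ∈ idealI n k := by
  by_cases han : a ≤ n
  · rw [coeff_prod_one_sub]
    exact Ideal.mul_mem_left _ _ (Ideal.subset_span (Or.inl ⟨a, ha, han, rfl⟩))
  · rw [coeff_prod_one_sub_of_lt]
    · exact Submodule.zero_mem _
    · simpa using han

/-- Modulo $I_{n,k}$, $\prod_l(1-x_lt)$ has degree at most $n-k$ in $t$, and its coefficients form a
vector `c` with last entry 1. Row `i` applied to `c` is the coefficient of degree $n-p_i$ in
$\prod_{l>p_i}(1-x_lt)$, whose degree is only $n-1-p_i$. So the matrix kills `c`, and the adjugate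
shows that its determinant is 0. -/
theorem det_flaggedMatrix_mem {n k : ℕ} (hkn : k ≤ n) (p : Fin (n - k + 1) → Fin n)
    (lam : Fin (n - k + 1) → ℕ) (h : ∀ i, (p i : ℕ) + lam i = k + i) :
    (flaggedMatrix p lam).det ∈ idealI n k := by
  rw [← Ideal.Quotient.eq_zero_iff_mem, RingHom.map_det]
  set φ := Ideal.Quotient.mk (idealI n k)
  set E : PowerSeries (MvPolynomial (Fin n) ℂ) :=
    ∏ l : Fin n, (1 - PowerSeries.C (X l) * PowerSeries.X) with hE
  set M := φ.mapMatrix (flaggedMatrix p lam) with hM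
  let c : Fin (n - k + 1) → ringR n k := fun a =>
    PowerSeries.coeff (n - k) (PowerSeries.X ^ (a : ℕ) * PowerSeries.map φ E)
  have hc : M.mulVec c = 0 := by
    funext i
    have e : M.mulVec c i = ∑ a : Fin (n - k + 1),
        PowerSeries.coeff (lam i + a)
          (PowerSeries.map φ (PowerSeries.X ^ (i : ℕ) * flagSeries (p i))) *
        PowerSeries.coeff (n - k) (PowerSeries.X ^ (a : ℕ) * PowerSeries.map φ E) := by
      change ∑ a, M i a * c a = _
      refine Finset.sum_congr rfl fun a _ => ?_
      rw [PowerSeries.coeff_map]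
      rfl
    have hprod : flagSeries (p i) * E =
        ∏ l ∈ Finset.Ioi (p i), (1 - PowerSeries.C (X l) * PowerSeries.X) := by
      have hd : (Finset.univ : Finset (Fin n)) =
          (Finset.Iic (p i)).disjUnion (Finset.Ioi (p i)) (by
          rw [Finset.disjoint_left]
          intro l h1 h2
          exact absurd (Finset.mem_Iic.1 h1) (not_le.2 (Finset.mem_Ioi.1 h2))) := by
        ext l
        simp [le_or_gt]
      rw [hE, hd, Finset.prod_disjUnion, flagSeries, ← mul_assoc, prod_geo_mul, one_mul]
    have hi := h i
    have hpi := (p i).2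
    rw [e, coeff_mul_eq_sum_fin _ _ _ (Nat.lt_succ_self _), ← map_mul, PowerSeries.coeff_map,
      mul_assoc, hprod, PowerSeries.coeff_X_pow_mul', if_pos (by omega),
      coeff_prod_one_sub_of_lt, map_zero]
    · rfl
    · rw [Fin.card_Ioi]
      omega
    · intro v hv
      rw [PowerSeries.coeff_map]
      exact Ideal.Quotient.eq_zero_iff_mem.2 (coeff_prod_one_sub_X_mem hv)
  have h1 : M.det • c = 0 := by
    have := congrArg (M.adjugate.mulVec) hc
    rwa [Matrix.mulVec_mulVec, Matrix.adjugate_mul, Matrix.smul_mulVec, Matrix.one_mulVec,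
      Matrix.mulVec_zero] at this
  have h2 : c (Fin.last (n - k)) = 1 := by
    simp only [c]
    rw [PowerSeries.coeff_X_pow_mul', if_pos (by simp), PowerSeries.coeff_map, Fin.val_last,
      Nat.sub_self, hE, coeff_prod_one_sub]
    simp
  have h3 := congrFun h1 (Fin.last (n - k))
  rw [Pi.smul_apply, h2] at h3
  simpa using h3

/-! ### Reversed skip sequences -/

/-- Enumerate the reversal of `S` increasingly as `p`. Exactly `n - k - i` elements of `S` lie below
the reversal of `p i`, which gives `p i + lam i = k + i`; since consecutive `p i` differ by at least
1, the parts are positive and weakly decreasing. -/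
theorem exists_flag_of_skip {n k : ℕ} (hkn : k ≤ n) (S : Finset (Fin n))
    (hS : S.card = n - k + 1) :
    ∃ p : Fin (n - k + 1) → Fin n, ∃ lam : Fin (n - k + 1) → ℕ, StrictMono p ∧
      (∀ i, (p i : ℕ) + lam i = k + i) ∧ (∀ i, 0 < lam i) ∧ Antitone lam ∧
      (∀ i, skip S (p i).rev = lam i) ∧ ∀ l, (∀ i, p i ≠ l) → skip S l.rev = 0 := by
  set P : Finset (Fin n) := S.map Fin.revPerm.toEmbedding with hP
  have hPS : ∀ l, l ∈ P ↔ l.rev ∈ S := by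
    intro l
    rw [hP, Finset.mem_map]
    constructor
    · rintro ⟨a, ha, rfl⟩
      simpa using ha
    · intro h
      exact ⟨_, h, by simp⟩
  have hcard : P.card = n - k + 1 := by rw [hP, Finset.card_map, hS]
  set p := P.orderEmbOfFin hcard with hp
  have hrange : ∀ l, l ∈ P ↔ ∃ i, p i = l := by
    intro l
    rw [← Finset.mem_coe, ← Finset.range_orderEmbOfFin P hcard]
    rfl
  have hp1 : StrictMono p := p.strictMono
  have hgap : ∀ d : ℕ, ∀ i j : Fin (n - k + 1), (i : ℕ) + d = j → (p i : ℕ) + d ≤ p j := by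
    intro d
    induction d with
    | zero =>
      intro i j hij
      rw [show i = j from Fin.ext hij, add_zero]
    | succ d ih =>
      intro i j hij
      have h1 := ih i ⟨i + d, by omega⟩ rfl
      have h2 : p ⟨i + d, by omega⟩ < p j := hp1 (Fin.lt_def.2 (by simp only; omega))
      rw [Fin.lt_def] at h2
      omega
  have hskip : ∀ i, skip S (p i).rev = (p i).rev + 1 - (n - k - i) := by
    intro i
    have hmem : (p i).rev ∈ S := (hPS _).1 ((hrange _).2 ⟨i, rfl⟩)
    have hc : (S.filter (· < (p i).rev)).card = n - k - i := by
      have : S.filter (· < (p i).rev) =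
          (Finset.Ioi i).map (p.toEmbedding.trans Fin.revPerm.toEmbedding) := by
        ext l
        simp only [Finset.mem_filter, Finset.mem_map, Finset.mem_Ioi]
        constructor
        · rintro ⟨h1, h2⟩
          obtain ⟨j, hj⟩ := (hrange l.rev).1 ((hPS _).2 (by simpa using h1))
          refine ⟨j, ?_, by simp [hj]⟩
          rw [← hp1.lt_iff_lt, hj, Fin.lt_rev_iff]
          exact h2
        · rintro ⟨j, hj, rfl⟩
          simp only [Function.Embedding.trans_apply, RelEmbedding.coe_toEmbedding,
            Equiv.coe_toEmbedding, Fin.revPerm_apply, Fin.rev_lt_rev]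
          exact ⟨(hPS _).1 ((hrange _).2 ⟨j, rfl⟩), hp1 hj⟩
      rw [this, Finset.card_map, Fin.card_Ioi]
      omega
    rw [skip, if_pos hmem, hc]
  have hlam : ∀ i, (p i : ℕ) + skip S (p i).rev = k + i := by
    intro i
    have h1 := hgap (n - k - i) i (Fin.last (n - k)) (by simp only [Fin.val_last]; omega)
    have h2 := (p (Fin.last (n - k))).2
    have h3 := (p i).2
    rw [hskip, Fin.val_rev]
    omega
  refine ⟨p, fun i => skip S (p i).rev, hp1, hlam, fun i => ?_, fun i j hij => ?_,
    fun i => rfl, fun l hl => ?_⟩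
  · have h1 := hgap (n - k - i) i (Fin.last (n - k)) (by simp only [Fin.val_last]; omega)
    have h2 := (p (Fin.last (n - k))).2
    have h3 := hlam i
    dsimp only
    omega
  · have h1 := hgap (j - i) i j (by rw [Fin.le_def] at hij; omega)
    have h2 := hlam i
    have h3 := hlam j
    rw [Fin.le_def] at hij
    dsimp only
    omega
  · rw [skip, if_neg]
    rw [← hPS, hrange]
    push Not
    exact hl

/-- The Demazure characters of reversed skip sequences lie in `I_{n,k}` and their initial monomial
is given by the indexing composition. -/
theorem demazure_skip {n k : ℕ} (hkn : k ≤ n) (S : Finset (Fin n)) (hS : S.card = n - k + 1) :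
    demazure (fun i => skip S i.rev) ∈ idealI n k ∧
      demazure (fun i => skip S i.rev) ≠ 0 ∧
      ∀ i, (neglex n).degree (demazure (fun i => skip S i.rev)) i = skip S i.rev := by
  obtain ⟨p, lam, hp, hlam, hpos, hanti, h1, h0⟩ := exists_flag_of_skip hkn S hS
  rw [demazure_eq_det p lam hp hanti hpos _ h1 h0]
  obtain ⟨hm, hd⟩ := monic_det_flaggedMatrix (Nat.succ_pos _) p lam hp hpos
  refine ⟨det_flaggedMatrix_mem hkn p lam hlam, hm.ne_zero, fun l => ?_⟩
  rw [hd]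
  by_cases hl : ∃ i, p i = l
  · obtain ⟨i, rfl⟩ := hl
    rw [sum_single_apply hp.injective, h1]
  · push Not at hl
    rw [sum_single_apply_of_forall_ne _ hl, h0 l hl]

end OrbitHarmonics
end

noncomputable section
namespace OrbitHarmonics
open MvPolynomial

/-! ### The associated graded ideal -/

section Graded

variable {n : ℕ}

theorem topComponent_ne_zero {f : MvPolynomial (Fin n) ℂ} (hf : f ≠ 0) : topComponent f ≠ 0 := by
  obtain ⟨d, hd, h⟩ := Finset.exists_mem_eq_sup f.support (support_nonempty.2 hf)
    fun s => s.sum fun _ e => e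
  intro h0
  have h1 := congrArg (coeff d) h0
  rw [topComponent, coeff_homogeneousComponent, if_pos] at h1
  · exact mem_support_iff.1 hd h1
  · exact h.symm

theorem eq_zero_or_totalDegree_lt {f : MvPolynomial (Fin n) ℂ} {d : ℕ} (hf : f.totalDegree ≤ d)
    (h : homogeneousComponent d f = 0) : f = 0 ∨ f.totalDegree < d := by
  by_contra! hc
  have : f.totalDegree = d := le_antisymm hf hc.2
  exact topComponent_ne_zero hc.1 (by rw [topComponent, this, h])

theorem homogeneousComponent_mem_grIdeal {I : Ideal (MvPolynomial (Fin n) ℂ)}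
    {f : MvPolynomial (Fin n) ℂ} (hf : f ∈ I) {d : ℕ} (hd : f.totalDegree ≤ d) :
    homogeneousComponent d f ∈ grIdeal I := by
  by_cases h : homogeneousComponent d f = 0
  · rw [h]
    exact Submodule.zero_mem _
  · have hd' : f.totalDegree = d := by
      refine le_antisymm hd (le_of_not_gt fun hlt => h (homogeneousComponent_eq_zero _ _ hlt))
    refine Ideal.subset_span ⟨f, hf, fun h0 => h (by rw [h0, map_zero]), ?_⟩
    rw [topComponent, hd']

theorem mem_grIdeal_of_isHomogeneous {I : Ideal (MvPolynomial (Fin n) ℂ)}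
    {f g : MvPolynomial (Fin n) ℂ} {d : ℕ} (hf : f.IsHomogeneous d) (hg : g ∈ I)
    (h : (g - f).totalDegree < d) : f ∈ grIdeal I := by
  have h1 : homogeneousComponent d g = f := by
    rw [← sub_add_cancel g f, map_add, homogeneousComponent_eq_zero _ _ h, zero_add,
      homogeneousComponent_eq_self hf]
  rw [← h1]
  refine homogeneousComponent_mem_grIdeal hg ?_
  rw [← sub_add_cancel g f]
  exact (totalDegree_add _ _).trans (max_le h.le hf.totalDegree_le)

theorem homogeneousComponent_zero_X_mul (i : Fin n) (f : MvPolynomial (Fin n) ℂ) :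
    homogeneousComponent 0 (f * X i) = 0 := by
  simp [homogeneousComponent_zero, coeff_mul_X']

theorem homogeneousComponent_succ_X_mul (d : ℕ) (i : Fin n) (f : MvPolynomial (Fin n) ℂ) :
    homogeneousComponent (d + 1) (f * X i) = homogeneousComponent d f * X i := by
  induction f using MvPolynomial.induction_on' with
  | monomial a c =>
    have h1 : (monomial a c : MvPolynomial (Fin n) ℂ).IsHomogeneous a.degree :=
      isHomogeneous_monomial c rfl
    rw [homogeneousComponent_of_mem h1, homogeneousComponent_of_mem (h1.mul (isHomogeneous_X ℂ i))]
    simp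
  | add p q hp hq => rw [add_mul, map_add, map_add, hp, hq, add_mul]

/-- Every homogeneous component of an element of `gr I` is the degree `d` component of an element
of `I` of degree at most `d`. -/
theorem exists_mem_of_mem_grIdeal {I : Ideal (MvPolynomial (Fin n) ℂ)}
    {f : MvPolynomial (Fin n) ℂ} (hf : f ∈ grIdeal I) (d : ℕ) :
    ∃ g ∈ I, g.totalDegree ≤ d ∧ homogeneousComponent d g = homogeneousComponent d f := by
  induction hf using Submodule.span_induction generalizing d with
  | mem x hx =>
    obtain ⟨f, hf, -, rfl⟩ := hx
    by_cases hd : f.totalDegree = d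
    · subst hd
      exact ⟨f, hf, le_rfl,
        (homogeneousComponent_eq_self (homogeneousComponent_isHomogeneous _ _)).symm⟩
    · refine ⟨0, Submodule.zero_mem _, by simp, ?_⟩
      rw [topComponent, homogeneousComponent_of_mem (homogeneousComponent_isHomogeneous _ _),
        if_neg (Ne.symm hd), map_zero]
  | zero => exact ⟨0, Submodule.zero_mem _, by simp, rfl⟩
  | add x y _ _ hx hy =>
    obtain ⟨g, hg, hgd, hgx⟩ := hx d
    obtain ⟨h, hh, hhd, hhy⟩ := hy d
    exact ⟨g + h, add_mem hg hh, (totalDegree_add _ _).trans (max_le hgd hhd), by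
      rw [map_add, map_add, hgx, hhy]⟩
  | smul a x _ hx =>
    induction a using MvPolynomial.induction_on generalizing d with
    | C c =>
      obtain ⟨g, hg, hgd, hgx⟩ := hx d
      refine ⟨C c * g, I.mul_mem_left _ hg, ?_, ?_⟩
      · refine (totalDegree_mul _ _).trans ?_
        rwa [totalDegree_C, zero_add]
      · rw [smul_eq_mul, homogeneousComponent_C_mul, homogeneousComponent_C_mul, hgx]
    | add p q hp hq =>
      obtain ⟨g, hg, hgd, hgx⟩ := hp d
      obtain ⟨h, hh, hhd, hhy⟩ := hq d
      exact ⟨g + h, add_mem hg hh, (totalDegree_add _ _).trans (max_le hgd hhd), by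
        rw [add_smul, map_add, map_add, hgx, hhy]⟩
    | mul_X p i hp =>
      have e : (p * X i) • x = (p • x) * X i := by
        simp only [smul_eq_mul]
        ring
      rw [e]
      cases d with
      | zero => exact ⟨0, Submodule.zero_mem _, by simp, by
          rw [homogeneousComponent_zero_X_mul, map_zero]⟩
      | succ d =>
        obtain ⟨g, hg, hgd, hgx⟩ := hp d
        refine ⟨g * X i, I.mul_mem_right _ hg, ?_, ?_⟩
        · refine (totalDegree_mul _ _).trans ?_
          rw [totalDegree_X]
          omega
        · rw [homogeneousComponent_succ_X_mul, homogeneousComponent_succ_X_mul, hgx]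

theorem homogeneousComponent_mem_of_mem_grIdeal {I : Ideal (MvPolynomial (Fin n) ℂ)}
    {f : MvPolynomial (Fin n) ℂ} (hf : f ∈ grIdeal I) (d : ℕ) :
    homogeneousComponent d f ∈ grIdeal I := by
  obtain ⟨g, hg, hgd, hgf⟩ := exists_mem_of_mem_grIdeal hf d
  rw [← hgf]
  exact homogeneousComponent_mem_grIdeal hg hgd

theorem rename_mem_grIdeal {I : Ideal (MvPolynomial (Fin n) ℂ)}
    (hI : ∀ (v : Equiv.Perm (Fin n)), ∀ f ∈ I, rename v f ∈ I) (v : Equiv.Perm (Fin n))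
    {f : MvPolynomial (Fin n) ℂ} (hf : f ∈ grIdeal I) : rename v f ∈ grIdeal I := by
  have : grIdeal I ≤ (grIdeal I).comap (rename v : MvPolynomial (Fin n) ℂ →ₐ[ℂ] _) := by
    refine Ideal.span_le.2 ?_
    rintro _ ⟨g, hg, -, rfl⟩
    change rename v (topComponent g) ∈ grIdeal I
    rw [topComponent, rename_homogeneousComponent]
    exact homogeneousComponent_mem_grIdeal (hI v g hg) (totalDegree_rename_le _ _)
  exact this hf

/-- An equivariant projection of polynomials onto a stable subspace. -/
theorem exists_equivariant_projection (G : Submodule ℂ (MvPolynomial (Fin n) ℂ))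
    (hG : ∀ v : Equiv.Perm (Fin n), ∀ f ∈ G, rename v f ∈ G) :
    ∃ q : MvPolynomial (Fin n) ℂ →ₗ[ℂ] MvPolynomial (Fin n) ℂ, (∀ f, q f ∈ G) ∧
      (∀ f ∈ G, q f = f) ∧ ∀ (v : Equiv.Perm (Fin n)) f, q (rename v f) = rename v (q f) := by
  obtain ⟨p, hp⟩ := LinearMap.exists_leftInverse_of_injective G.subtype (Submodule.ker_subtype G)
  let ρ : Equiv.Perm (Fin n) → MvPolynomial (Fin n) ℂ →ₗ[ℂ] MvPolynomial (Fin n) ℂ :=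
    fun v => (rename v : MvPolynomial (Fin n) ℂ →ₐ[ℂ] _).toLinearMap
  have hρ : ∀ u v f, ρ u (ρ v f) = ρ (u * v) f := fun u v f => rename_rename _ _ _
  have hpG : ∀ f ∈ G, (p f : MvPolynomial (Fin n) ℂ) = f := fun f hf =>
    congrArg Subtype.val (LinearMap.congr_fun hp ⟨f, hf⟩)
  have hcard : (Fintype.card (Equiv.Perm (Fin n)) : ℂ) ≠ 0 :=
    Nat.cast_ne_zero.2 Fintype.card_ne_zero
  -- Maschke averaging of an arbitrary linear projection over `S_n`.
  refine ⟨(Fintype.card (Equiv.Perm (Fin n)) : ℂ)⁻¹ •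
    ∑ v, (ρ v) ∘ₗ G.subtype ∘ₗ p ∘ₗ (ρ v⁻¹), ?_, ?_, ?_⟩
  · intro f
    rw [LinearMap.smul_apply, LinearMap.sum_apply]
    exact G.smul_mem _ (Submodule.sum_mem _ fun v _ => hG v _ (p _).2)
  · intro f hf
    rw [LinearMap.smul_apply, LinearMap.sum_apply]
    have : ∀ v, ((ρ v) ∘ₗ G.subtype ∘ₗ p ∘ₗ (ρ v⁻¹)) f = f := by
      intro v
      change ρ v (p (ρ v⁻¹ f)) = f
      have hfG : ρ v⁻¹ f ∈ G := hG _ _ hf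
      rw [hpG _ hfG, hρ, mul_inv_cancel]
      exact rename_id_apply f
    simp only [this]
    rw [Finset.sum_const, Finset.card_univ, ← Nat.cast_smul_eq_nsmul ℂ, smul_smul,
      inv_mul_cancel₀ hcard, one_smul]
  · intro u f
    rw [LinearMap.smul_apply, LinearMap.smul_apply, map_smul, LinearMap.sum_apply,
      LinearMap.sum_apply, map_sum]
    congr 1
    refine Fintype.sum_equiv (Equiv.mulLeft u⁻¹) _ _ fun v => ?_
    change ρ v (p (ρ v⁻¹ (ρ u f))) = ρ u (ρ (u⁻¹ * v) (p (ρ (u⁻¹ * v)⁻¹ f)))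
    rw [hρ, hρ, mul_inv_rev, inv_inv, mul_inv_cancel_left]

/-- For an ideal `I` stable under permutations of the variables, an equivariant linear
endomorphism which realizes the quotient by `gr I` inside the quotient by `I`. -/
theorem exists_equivariant_grading (I : Ideal (MvPolynomial (Fin n) ℂ))
    (hI : ∀ (v : Equiv.Perm (Fin n)), ∀ f ∈ I, rename v f ∈ I) :
    ∃ L : MvPolynomial (Fin n) ℂ →ₗ[ℂ] MvPolynomial (Fin n) ℂ,
      (∀ (v : Equiv.Perm (Fin n)) f, L (rename v f) = rename v (L f)) ∧
      (∀ f, L f ∈ I ↔ f ∈ grIdeal I) ∧ ∀ f, ∃ g, f - L g ∈ I := by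
  have hq : ∀ d : ℕ, ∃ q : MvPolynomial (Fin n) ℂ →ₗ[ℂ] MvPolynomial (Fin n) ℂ,
      (∀ f, (q f).IsHomogeneous d ∧ q f ∈ grIdeal I) ∧
      (∀ f, f.IsHomogeneous d → f ∈ grIdeal I → q f = f) ∧
      ∀ (v : Equiv.Perm (Fin n)) f, q (rename v f) = rename v (q f) := by
    intro d
    obtain ⟨q, h1, h2, h3⟩ := exists_equivariant_projection
      (homogeneousSubmodule (Fin n) ℂ d ⊓ (grIdeal I).restrictScalars ℂ)
      (fun v f hf => ⟨hf.1.rename_isHomogeneous, rename_mem_grIdeal hI v hf.2⟩)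
    exact ⟨q, fun f => h1 f, fun f hf hf' => h2 f ⟨hf, hf'⟩, h3⟩
  choose q hqmem hqid hqv using hq
  -- In each degree `L` is the identity minus the equivariant projection onto that part of `gr I`.
  -- It preserves degree and has kernel `gr I`.
  let L : MvPolynomial (Fin n) ℂ →ₗ[ℂ] MvPolynomial (Fin n) ℂ :=
    (basisMonomials (Fin n) ℂ).constr ℂ fun a => monomial a 1 - q a.degree (monomial a 1)
  have hLmon : ∀ a c, L (monomial a c) = monomial a c - q a.degree (monomial a c) := by
    intro a c
    have h1 : L (monomial a 1) = monomial a 1 - q a.degree (monomial a 1) := by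
      have := (basisMonomials (Fin n) ℂ).constr_basis ℂ
        (fun a => monomial a 1 - q a.degree (monomial a 1)) a
      rwa [coe_basisMonomials] at this
    have h2 : (monomial a c : MvPolynomial (Fin n) ℂ) = c • monomial a 1 := by
      rw [smul_monomial, smul_eq_mul, mul_one]
    rw [h2, map_smul, h1, map_smul, smul_sub]
  have hLv : ∀ (v : Equiv.Perm (Fin n)) f, L (rename v f) = rename v (L f) := by
    intro v f
    induction f using MvPolynomial.induction_on' with
    | monomial a c =>
      rw [rename_monomial, hLmon, hLmon, Finsupp.degree_mapDomain, ← rename_monomial, hqv, map_sub]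
    | add f g hf hg => rw [map_add, map_add, hf, hg, map_add, map_add]
  have hLhom : ∀ d f, L (homogeneousComponent d f) =
      homogeneousComponent d f - q d (homogeneousComponent d f) := by
    intro d f
    induction f using MvPolynomial.induction_on' with
    | monomial a c =>
      rw [homogeneousComponent_of_mem (isHomogeneous_monomial c rfl)]
      split_ifs with h
      · rw [hLmon, h]
      · simp
    | add f g hf hg =>
      rw [map_add, map_add, map_add, hf, hg]
      ring
  have hLcomp : ∀ d f, homogeneousComponent d (L f) = L (homogeneousComponent d f) := by
    intro d f
    induction f using MvPolynomial.induction_on' with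
    | monomial a c =>
      have h1 : (monomial a c : MvPolynomial (Fin n) ℂ).IsHomogeneous a.degree :=
        isHomogeneous_monomial c rfl
      rw [hLmon, homogeneousComponent_of_mem (h1.sub (hqmem _ _).1),
        homogeneousComponent_of_mem h1]
      split_ifs with h
      · rw [hLmon]
      · simp
    | add f g hf hg => rw [map_add, map_add, hf, hg, map_add, map_add]
  have hLzero : ∀ f, (∀ d, L (homogeneousComponent d f) = 0) → L f = 0 := by
    intro f hf
    rw [← sum_homogeneousComponent f, map_sum]
    exact Finset.sum_eq_zero fun d _ => hf d
  refine ⟨L, hLv, fun f => ⟨fun hf => ?_, fun hf => ?_⟩, ?_⟩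
  -- If `L f ∈ I`, its top component lies in `gr I`, so the projection fixes it; but the projection
  -- also kills everything in the image of `L` in that degree.
  · have h0 : L f = 0 := by
      by_contra hne
      have h1 := homogeneousComponent_mem_grIdeal hf le_rfl
      have h2 := hqid _ _ (homogeneousComponent_isHomogeneous _ _) h1
      rw [hLcomp, hLhom, map_sub, hqid _ (q _ _) (hqmem _ _).1 (hqmem _ _).2, sub_self] at h2
      refine topComponent_ne_zero hne ?_
      rw [topComponent, hLcomp, hLhom]
      exact h2.symm
    rw [← sum_homogeneousComponent f]
    refine Submodule.sum_mem _ fun d _ => ?_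
    have h1 := hLhom d f
    rw [← hLcomp, h0, map_zero, eq_comm, sub_eq_zero] at h1
    rw [h1]
    exact (hqmem _ _).2
  · rw [hLzero]
    · exact Submodule.zero_mem _
    · intro d
      rw [hLhom, hqid _ _ (homogeneousComponent_isHomogeneous _ _)
        (homogeneousComponent_mem_of_mem_grIdeal hf d), sub_self]
  -- Induction on the degree. The part `q d c` of the top component `c` is also the top component of
  -- some `h ∈ I`, so `f - h - L c` has smaller degree.
  · have key : ∀ d f, f.totalDegree < d → ∃ g, f - L g ∈ I := by
      intro d
      induction d with
      | zero => intro f hf; omega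
      | succ d ih =>
        intro f hf
        set c := homogeneousComponent d f with hc
        have hchom : c.IsHomogeneous d := homogeneousComponent_isHomogeneous _ _
        obtain ⟨h, hhI, hhd, hh⟩ := exists_mem_of_mem_grIdeal (hqmem d c).2 d
        rw [homogeneousComponent_eq_self (hqmem d c).1] at hh
        have hLc : L c = c - q d c := hLhom d f
        have hdeg : (f - h - L c).totalDegree ≤ d := by
          refine (totalDegree_sub _ _).trans (max_le ((totalDegree_sub _ _).trans
            (max_le (by omega) hhd)) ?_)
          rw [hLc]
          exact (hchom.sub (hqmem d c).1).totalDegree_le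
        have hcomp : homogeneousComponent d (f - h - L c) = 0 := by
          rw [map_sub, map_sub, hh, hLcomp, homogeneousComponent_eq_self hchom, hLc, ← hc]
          ring
        rcases eq_zero_or_totalDegree_lt hdeg hcomp with h0 | hlt
        · refine ⟨c, ?_⟩
          have : f - L c = h := by linear_combination h0
          rwa [this]
        · obtain ⟨g, hg⟩ := ih _ hlt
          refine ⟨c + g, ?_⟩
          have : f - L (c + g) = (f - h - L c - L g) + h := by
            rw [map_add]
            ring
          rw [this]
          exact add_mem hg hhI
    exact fun f => key _ f (Nat.lt_succ_self _)

end Graded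

/-! ### The point locus -/

section Locus

variable {n k : ℕ} (α : Fin k → ℂ)

theorem rename_mem_vanishingIdeal (v : Equiv.Perm (Fin n)) (f : MvPolynomial (Fin n) ℂ)
    (hf : f ∈ vanishingIdeal ℂ (locusZ n k α)) :
    rename v f ∈ vanishingIdeal ℂ (locusZ n k α) := by
  rw [mem_vanishingIdeal_iff] at hf ⊢
  rintro _ ⟨w, rfl⟩
  rw [aeval_rename]
  exact hf _ ⟨v⁻¹ • w, rfl⟩

/-- Each coordinate of a point of the locus is a root of $\prod_j(x-\alpha_j)$, which is monic of
degree `k`. -/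
theorem X_pow_mem_grIdeal (hk : 0 < k) (i : Fin n) :
    (X i ^ k : MvPolynomial (Fin n) ℂ) ∈ grIdeal (vanishingIdeal ℂ (locusZ n k α)) := by
  set Q : Polynomial ℂ := ∏ j, (Polynomial.X - Polynomial.C (α j)) with hQ
  have hmonic : Q.Monic := Polynomial.monic_prod_X_sub_C _ _
  have hdeg : Q.natDegree = k := by
    rw [hQ, Polynomial.natDegree_prod_of_monic _ _ fun j _ => Polynomial.monic_X_sub_C _]
    simp
  refine mem_grIdeal_of_isHomogeneous (g := Polynomial.aeval (X i) Q) (d := k)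
    (isHomogeneous_X_pow i k) ?_ ?_
  · rw [mem_vanishingIdeal_iff]
    rintro _ ⟨w, rfl⟩
    rw [← Polynomial.aeval_algHom_apply, aeval_X, hQ, map_prod]
    exact Finset.prod_eq_zero (Finset.mem_univ (w.1 i)) (by simp)
  · have : Polynomial.aeval (X i) Q - X i ^ k =
        ∑ d ∈ Finset.range k, C (Q.coeff d) * (X i : MvPolynomial (Fin n) ℂ) ^ d := by
      conv_lhs => rw [hmonic.as_sum, hdeg]
      simp [map_sum, algebraMap_eq]
    rw [this]
    refine Nat.lt_of_le_pred hk (totalDegree_finsetSum_le fun d hd => ?_)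
    refine (totalDegree_mul _ _).trans ?_
    rw [totalDegree_C, totalDegree_X_pow, zero_add]
    exact Nat.le_pred_of_lt (Finset.mem_range.1 hd)

theorem isHomogeneous_coeff_prod (r : ℕ) :
    (PowerSeries.coeff r (∏ l : Fin n, (1 - PowerSeries.C (X l : MvPolynomial (Fin n) ℂ) *
      PowerSeries.X))).IsHomogeneous r := by
  rw [coeff_prod_one_sub]
  have h1 : ((-1) ^ r : MvPolynomial (Fin n) ℂ) = C ((-1) ^ r) := by simp
  rw [h1]
  refine IsHomogeneous.C_mul (IsHomogeneous.sum _ _ _ fun t ht => ?_) _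
  have := IsHomogeneous.prod t (fun i => (X i : MvPolynomial (Fin n) ℂ)) (fun _ => 1)
    fun i _ => isHomogeneous_X ℂ i
  rwa [Finset.sum_const, smul_eq_mul, mul_one, (Finset.mem_powersetCard.1 ht).2] at this

/-- At a point `z` of the locus every $\alpha_j$ occurs among the coordinates, so
$\prod_l(1-z_lt)/\prod_j(1-\alpha_jt)$ is a polynomial of degree at most $n-k$. Its later
coefficients vanish there, and as polynomials in `x` they differ from those of the numerator by
terms of lower degree. -/
theorem coeff_prod_mem_grIdeal (r : ℕ) (hr : n - k < r) :
    PowerSeries.coeff r (∏ l : Fin n, (1 - PowerSeries.C (X l : MvPolynomial (Fin n) ℂ) *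
      PowerSeries.X)) ∈ grIdeal (vanishingIdeal ℂ (locusZ n k α)) := by
  set E : PowerSeries (MvPolynomial (Fin n) ℂ) :=
    ∏ l : Fin n, (1 - PowerSeries.C (X l) * PowerSeries.X) with hE
  set H : PowerSeries ℂ := ∏ j, geo (α j) with hH
  have hH0 : PowerSeries.coeff 0 H = 1 := by
    rw [hH, PowerSeries.coeff_zero_eq_constantCoeff_apply, map_prod]
    refine Finset.prod_eq_one fun l _ => ?_
    rw [← PowerSeries.coeff_zero_eq_constantCoeff_apply, coeff_geo, pow_zero]
  refine mem_grIdeal_of_isHomogeneous (d := r)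
    (g := PowerSeries.coeff r (PowerSeries.map C H * E)) (isHomogeneous_coeff_prod r) ?_ ?_
  · rw [mem_vanishingIdeal_iff]
    rintro _ ⟨w, rfl⟩
    set z : Fin n → ℂ := fun i => α (w.1 i) with hz
    change (aeval z : MvPolynomial (Fin n) ℂ →ₐ[ℂ] ℂ).toRingHom _ = 0
    have h1 : PowerSeries.map (aeval z : MvPolynomial (Fin n) ℂ →ₐ[ℂ] ℂ).toRingHom
        (PowerSeries.map C H) = H := by
      ext d
      simp
    have h2 : ∀ l, PowerSeries.map (aeval z : MvPolynomial (Fin n) ℂ →ₐ[ℂ] ℂ).toRingHom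
        (1 - PowerSeries.C (X l) * PowerSeries.X) =
        1 - PowerSeries.C (z l) * PowerSeries.X := by
      intro l
      simp
    rw [← PowerSeries.coeff_map, map_mul (PowerSeries.map _), h1, hE, map_prod]
    simp only [h2]
    -- Choose one position for each letter; those factors cancel the denominator and `n - k`
    -- positions remain.
    obtain ⟨s, hs⟩ := w.2.hasRightInverse
    set T : Finset (Fin n) := Finset.univ.map ⟨s, hs.injective⟩ with hT
    have h3 : ∏ l ∈ T, (1 - PowerSeries.C (z l) * PowerSeries.X) =
        ∏ j, (1 - PowerSeries.C (α j) * PowerSeries.X) := by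
      rw [hT, Finset.prod_map]
      refine Finset.prod_congr rfl fun j _ => ?_
      simp only [hz, Function.Embedding.coeFn_mk]
      rw [hs j]
    rw [← Finset.prod_mul_prod_compl T, h3, hH, ← mul_assoc, prod_geo_mul, one_mul]
    refine coeff_prod_one_sub_of_lt _ _ ?_
    rw [Finset.card_compl, hT, Finset.card_map, Finset.card_univ, Fintype.card_fin,
      Fintype.card_fin]
    exact hr
  · rw [PowerSeries.coeff_mul, Finset.Nat.sum_antidiagonal_eq_sum_range_succ
      (fun u v => PowerSeries.coeff u (PowerSeries.map C H) * PowerSeries.coeff v E),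
      Finset.sum_range_succ', PowerSeries.coeff_map, hH0, map_one, one_mul, Nat.sub_zero,
      add_sub_cancel_right]
    refine Nat.lt_of_le_pred (by omega) (totalDegree_finsetSum_le fun d hd => ?_)
    refine (totalDegree_mul _ _).trans ?_
    rw [PowerSeries.coeff_map, totalDegree_C, zero_add]
    refine (isHomogeneous_coeff_prod _).totalDegree_le.trans ?_
    simp only [Nat.pred_eq_sub_one]
    omega

theorem idealI_le_grIdeal (hk : 0 < k) :
    idealI n k ≤ grIdeal (vanishingIdeal ℂ (locusZ n k α)) := by
  refine Ideal.span_le.2 ?_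
  rintro f (⟨r, h1, h2, rfl⟩ | ⟨i, rfl⟩)
  · have h3 := coeff_prod_mem_grIdeal (n := n) α r (by omega)
    rw [coeff_prod_one_sub] at h3
    have h4 := Ideal.mul_mem_left _ ((-1) ^ r) h3
    rw [← mul_assoc, ← mul_pow, neg_one_mul, neg_neg, one_pow, one_mul] at h4
    exact h4
  · exact X_pow_mem_grIdeal α hk i

/-- Evaluation at the points of the locus, as a map to `ℂ[W_{n,k}]`. -/
def evalLocus (n : ℕ) (α : Fin k → ℂ) :
    MvPolynomial (Fin n) ℂ →ₗ[ℂ] MonoidAlgebra ℂ (FubiniWord n k) :=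
  (MonoidAlgebra.coeffLinearEquiv ℂ).symm.toLinearMap ∘ₗ
    (Finsupp.linearEquivFunOnFinite ℂ ℂ (FubiniWord n k)).symm.toLinearMap ∘ₗ
      LinearMap.pi fun w => (aeval fun i => α (w.1 i) : MvPolynomial (Fin n) ℂ →ₐ[ℂ] ℂ).toLinearMap

theorem coeff_evalLocus (f : MvPolynomial (Fin n) ℂ) (w : FubiniWord n k) :
    (evalLocus n α f).coeff w = aeval (fun i => α (w.1 i)) f := rfl

theorem evalLocus_eq_zero_iff (f : MvPolynomial (Fin n) ℂ) :
    evalLocus n α f = 0 ↔ f ∈ vanishingIdeal ℂ (locusZ n k α) := by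
  rw [mem_vanishingIdeal_iff]
  constructor
  · rintro h _ ⟨w, rfl⟩
    rw [← coeff_evalLocus, h]
    rfl
  · intro h
    ext w
    rw [coeff_evalLocus]
    exact h _ ⟨w, rfl⟩

/-- Lagrange interpolation on the grid $\{\alpha_1,\dots,\alpha_k\}^n$, which contains the locus. -/
theorem evalLocus_surjective (hα : Function.Injective α) :
    Function.Surjective (evalLocus n α) := by
  rw [← LinearMap.range_eq_top, eq_top_iff]
  intro x _
  induction x using MonoidAlgebra.induction_linear with
  | zero => exact Submodule.zero_mem _
  | add f g hf hg => exact add_mem (hf trivial) (hg trivial)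
  | single w c =>
    set F : MvPolynomial (Fin n) ℂ :=
      ∏ i, ∏ j ∈ Finset.univ.erase (w.1 i), (X i - C (α j)) with hF
    have hne : aeval (fun i => α (w.1 i)) F ≠ 0 := by
      rw [hF, map_prod, Finset.prod_ne_zero_iff]
      intro i _
      rw [map_prod, Finset.prod_ne_zero_iff]
      intro j hj
      rw [map_sub, aeval_X, aeval_C]
      exact sub_ne_zero.2 (hα.ne (Finset.ne_of_mem_erase hj).symm)
    refine ⟨(c / aeval (fun i => α (w.1 i)) F) • F, ?_⟩
    ext u
    rw [coeff_evalLocus, map_smul, MonoidAlgebra.coeff_single]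
    by_cases hu : u = w
    · subst hu
      rw [Finsupp.single_eq_same, smul_eq_mul, div_mul_cancel₀ _ hne]
    · rw [Finsupp.single_eq_of_ne hu]
      obtain ⟨i, hi⟩ : ∃ i, u.1 i ≠ w.1 i := by
        by_contra! h
        exact hu (Subtype.ext (funext h))
      have h0 : aeval (fun i => α (u.1 i)) F = 0 := by
        rw [hF, map_prod]
        refine Finset.prod_eq_zero (Finset.mem_univ i) ?_
        rw [map_prod]
        exact Finset.prod_eq_zero (Finset.mem_erase.2 ⟨hi, Finset.mem_univ _⟩) (by simp)
      rw [h0, smul_zero]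

theorem evalLocus_rename (v : Equiv.Perm (Fin n)) (f : MvPolynomial (Fin n) ℂ) :
    evalLocus n α (rename v f) = repFubini n k v (evalLocus n α f) := by
  ext w
  rw [Representation.coeff_ofMulAction, coeff_evalLocus, coeff_evalLocus, aeval_rename]
  rfl

end Locus

/-! ### Initial ideals and division -/

section Initial

variable {n : ℕ}

theorem monomial_mem_initialIdeal_iff (m : MonomialOrder (Fin n))
    (I : Ideal (MvPolynomial (Fin n) ℂ)) (a : Fin n →₀ ℕ) :
    monomial a 1 ∈ initialIdeal m I ↔ ∃ f ∈ I, f ≠ 0 ∧ m.degree f ≤ a := by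
  have : {g | ∃ f ∈ I, f ≠ 0 ∧ g = initialMonomial m f} =
      (fun s => monomial s (1 : ℂ)) '' {d | ∃ f ∈ I, f ≠ 0 ∧ d = m.degree f} := by
    ext g
    constructor
    · rintro ⟨f, h1, h2, rfl⟩
      exact ⟨_, ⟨f, h1, h2, rfl⟩, rfl⟩
    · rintro ⟨_, ⟨f, h1, h2, rfl⟩, rfl⟩
      exact ⟨f, h1, h2, rfl⟩
  rw [initialIdeal, this, mem_ideal_span_monomial_image]
  classical
  rw [support_monomial, if_neg one_ne_zero]
  simp only [Finset.mem_singleton, forall_eq]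
  constructor
  · rintro ⟨_, ⟨f, h1, h2, rfl⟩, h⟩
    exact ⟨f, h1, h2, h⟩
  · rintro ⟨f, h1, h2, h⟩
    exact ⟨_, ⟨f, h1, h2, rfl⟩, h⟩

/-- Every polynomial is congruent modulo `I` to a combination of standard monomials. -/
theorem exists_standard_remainder (m : MonomialOrder (Fin n))
    (I : Ideal (MvPolynomial (Fin n) ℂ)) (f : MvPolynomial (Fin n) ℂ) :
    ∃ r, f - r ∈ I ∧ ∀ c ∈ r.support, monomial c 1 ∉ initialIdeal m I := by
  -- Divide by all nonzero elements of `I` at once; their leading coefficients are units in the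
  -- field.
  obtain ⟨g, r, h1, -, h3⟩ := m.div_set (B := {b | b ∈ I ∧ b ≠ 0})
    (fun b hb => isUnit_iff_ne_zero.2 (m.leadingCoeff_ne_zero_iff.2 hb.2)) f
  refine ⟨r, ?_, fun c hc hmem => ?_⟩
  · rw [h1, add_sub_cancel_right, Finsupp.linearCombination_apply]
    exact Submodule.sum_mem _ fun b _ => I.mul_mem_left _ b.2.1
  · obtain ⟨b, hb, hb0, hle⟩ := (monomial_mem_initialIdeal_iff m I c).1 hmem
    exact h3 c hc b ⟨hb, hb0⟩ hle

end Initial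

end OrbitHarmonics
end

noncomputable section
namespace OrbitHarmonics
open MvPolynomial

/-! ### The quotient ring `R_{n,k}` -/

section Main

variable {n k : ℕ}

theorem finite_groebnerSet (n k : ℕ) : (groebnerSet n k).Finite := by
  refine Set.Finite.union ?_ ?_
  · refine (Set.finite_range fun S : Finset (Fin n) => demazure fun i => skip S i.rev).subset ?_
    rintro _ ⟨S, -, rfl⟩
    exact ⟨S, rfl⟩
  · refine (Set.finite_range fun i : Fin n => (X i ^ k : MvPolynomial (Fin n) ℂ)).subset ?_
    rintro _ ⟨i, rfl⟩
    exact ⟨i, rfl⟩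

theorem groebnerSet_subset (hkn : k ≤ n) {g : MvPolynomial (Fin n) ℂ} (hg : g ∈ groebnerSet n k) :
    g ∈ idealI n k ∧ g ≠ 0 := by
  obtain ⟨S, hS, rfl⟩ | ⟨i, rfl⟩ := hg
  · exact ⟨(demazure_skip hkn S hS).1, (demazure_skip hkn S hS).2.1⟩
  · exact ⟨Ideal.subset_span (Or.inr ⟨i, rfl⟩), pow_ne_zero _ (X_ne_zero i)⟩

/-- A monomial divisible by no initial monomial of the Gröbner basis is substaircase. -/
theorem isSubstaircase_of_forall_not_le (hk : 0 < k) (hkn : k ≤ n) (a : Fin n →₀ ℕ)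
    (ha : ∀ g ∈ groebnerSet n k, ¬ (neglex n).degree g ≤ a) : IsSubstaircase n k a := by
  refine isSubstaircase_of_nonskip hk hkn a (fun i => ?_) fun S hS hle => ?_
  · by_contra! h
    refine ha _ (Or.inr ⟨i, rfl⟩) ?_
    rw [MonomialOrder.degree_pow, MonomialOrder.degree_X, Finsupp.smul_single, smul_eq_mul,
      mul_one, Finsupp.single_le_iff]
    exact h
  · refine ha _ (Or.inl ⟨S, hS, rfl⟩) fun i => ?_
    rw [(demazure_skip hkn S hS).2.2]
    exact hle i

theorem isSubstaircase_of_notMem_initialIdeal (hk : 0 < k) (hkn : k ≤ n) (a : Fin n →₀ ℕ)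
    (ha : monomial a 1 ∉ initialIdeal (neglex n) (idealI n k)) : IsSubstaircase n k a :=
  isSubstaircase_of_forall_not_le hk hkn a fun g hg hle =>
    ha ((monomial_mem_initialIdeal_iff _ _ _).2
      ⟨g, (groebnerSet_subset hkn hg).1, (groebnerSet_subset hkn hg).2, hle⟩)

/-- The residue class of a substaircase monomial. -/
def substaircaseClass (n k : ℕ) (a : {a : Fin n →₀ ℕ // IsSubstaircase n k a}) : ringR n k :=
  Ideal.Quotient.mk (idealI n k) (monomial a.1 1)

/-- The span uses only those substaircase monomials that are standard, which is more than the
dimension bound needs. Linear independence of all of them will then force each one to be standard.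
-/
theorem mk_mem_span_standard (hk : 0 < k) (hkn : k ≤ n) (x : ringR n k) :
    x ∈ Submodule.span ℂ (substaircaseClass n k ''
      {a | monomial a.1 1 ∉ initialIdeal (neglex n) (idealI n k)}) := by
  obtain ⟨f, rfl⟩ := Ideal.Quotient.mk_surjective x
  obtain ⟨r, hr, hstd⟩ := exists_standard_remainder (neglex n) (idealI n k) f
  rw [Ideal.Quotient.eq.2 hr, r.as_sum, map_sum]
  refine Submodule.sum_mem _ fun c hc => ?_
  have h1 : (monomial c (coeff c r) : MvPolynomial (Fin n) ℂ) = coeff c r • monomial c 1 := by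
    rw [smul_monomial, smul_eq_mul, mul_one]
  rw [h1]
  change Ideal.Quotient.mkₐ ℂ (idealI n k) _ ∈ _
  rw [map_smul]
  exact Submodule.smul_mem _ _ (Submodule.subset_span
    ⟨⟨c, isSubstaircase_of_notMem_initialIdeal hk hkn c (hstd c hc)⟩, hstd c hc, rfl⟩)

theorem span_substaircaseClass (hk : 0 < k) (hkn : k ≤ n) :
    ⊤ ≤ Submodule.span ℂ (Set.range (substaircaseClass n k)) := fun x _ =>
  Submodule.span_mono (Set.image_subset_range _ _) (mk_mem_span_standard hk hkn x)

theorem finite_ringR (hk : 0 < k) (hkn : k ≤ n) : Module.Finite ℂ (ringR n k) :=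
  have := finite_isSubstaircase n k hk
  ⟨Submodule.fg_def.2 ⟨_, Set.finite_range _, eq_top_iff.2 (span_substaircaseClass hk hkn)⟩⟩

theorem finrank_monoidAlgebra_fubiniWord (n k : ℕ) :
    Module.finrank ℂ (MonoidAlgebra ℂ (FubiniWord n k)) = Nat.card (FubiniWord n k) := by
  rw [(MonoidAlgebra.coeffLinearEquiv ℂ).finrank_eq, Module.finrank_finsupp_self,
    Nat.card_eq_fintype_card]

/-- Compose `L` from `exists_equivariant_grading` with evaluation on the locus. The composite has
kernel `gr I(Z)`, which contains $I_{n,k}$, so it descends to the quotient. -/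
theorem exists_surjective_intertwining (hk : 0 < k) (α : Fin k → ℂ) (hα : Function.Injective α) :
    ∃ ψ : ringR n k →ₗ[ℂ] MonoidAlgebra ℂ (FubiniWord n k), Function.Surjective ψ ∧
      (∀ v, ψ ∘ₗ repR n k v = repFubini n k v ∘ₗ ψ) ∧
      ∀ f, ψ (Ideal.Quotient.mk _ f) = 0 ↔ f ∈ grIdeal (vanishingIdeal ℂ (locusZ n k α)) := by
  obtain ⟨L, hLv, hLI, hLs⟩ := exists_equivariant_grading (vanishingIdeal ℂ (locusZ n k α))
    (rename_mem_vanishingIdeal α)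
  have hker : ∀ f, evalLocus n α (L f) = 0 ↔
      f ∈ grIdeal (vanishingIdeal ℂ (locusZ n k α)) := fun f => by
    rw [evalLocus_eq_zero_iff, hLI]
  let ψ : ringR n k →ₗ[ℂ] MonoidAlgebra ℂ (FubiniWord n k) :=
    Submodule.liftQ ((idealI n k).restrictScalars ℂ) (evalLocus n α ∘ₗ L)
      fun f hf => (hker f).2 (idealI_le_grIdeal α hk hf)
  have hψ : ∀ f, ψ (Ideal.Quotient.mk _ f) = evalLocus n α (L f) := fun f => rfl
  refine ⟨ψ, fun x => ?_, fun v => LinearMap.ext fun x => ?_, fun f => ?_⟩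
  · obtain ⟨f, rfl⟩ := evalLocus_surjective α hα x
    obtain ⟨g, hg⟩ := hLs f
    refine ⟨Ideal.Quotient.mk _ g, ?_⟩
    rw [hψ, eq_comm, ← sub_eq_zero, ← map_sub, evalLocus_eq_zero_iff]
    exact hg
  · obtain ⟨f, rfl⟩ := Ideal.Quotient.mk_surjective x
    rw [LinearMap.comp_apply, LinearMap.comp_apply, repR_mk, hψ, hψ, hLv, evalLocus_rename]
  · rw [hψ, hker]

theorem finrank_ringR (hk : 0 < k) (hkn : k ≤ n) :
    Module.finrank ℂ (ringR n k) = Nat.card (FubiniWord n k) := by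
  have := finite_ringR hk hkn
  have := finite_isSubstaircase n k hk
  have := Fintype.ofFinite {a : Fin n →₀ ℕ // IsSubstaircase n k a}
  refine le_antisymm ?_ ?_
  · rw [← card_isSubstaircase n k hk, Nat.card_eq_fintype_card,
      ← finrank_top ℂ (ringR n k), ← eq_top_iff.2 (span_substaircaseClass hk hkn)]
    exact finrank_range_le_card _
  -- The ring does not involve `α`, so any distinct values serve; here `0, 1, …, k - 1`.
  · obtain ⟨ψ, hψ, -⟩ := exists_surjective_intertwining (n := n) hk
      (fun j : Fin k => ((j : ℕ) : ℂ)) fun i j h => Fin.ext (Nat.cast_injective h)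
    rw [← finrank_monoidAlgebra_fubiniWord]
    exact ψ.finrank_le_finrank_of_surjective hψ

theorem linearIndependent_substaircaseClass (hk : 0 < k) (hkn : k ≤ n) :
    LinearIndependent ℂ (substaircaseClass n k) := by
  have := finite_isSubstaircase n k hk
  have := Fintype.ofFinite {a : Fin n →₀ ℕ // IsSubstaircase n k a}
  refine linearIndependent_of_top_le_span_of_card_eq_finrank (span_substaircaseClass hk hkn) ?_
  rw [finrank_ringR hk hkn, ← card_isSubstaircase n k hk, Nat.card_eq_fintype_card]

/-- A substaircase monomial in the initial ideal would have its class in the span of the other,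
standard ones, against linear independence. -/
theorem monomial_notMem_initialIdeal_iff (hk : 0 < k) (hkn : k ≤ n) (a : Fin n →₀ ℕ) :
    monomial a 1 ∉ initialIdeal (neglex n) (idealI n k) ↔ IsSubstaircase n k a := by
  refine ⟨isSubstaircase_of_notMem_initialIdeal hk hkn a, fun ha hmem => ?_⟩
  refine (linearIndependent_substaircaseClass hk hkn).notMem_span_image
    (s := {a | monomial a.1 1 ∉ initialIdeal (neglex n) (idealI n k)}) (x := ⟨a, ha⟩) ?_
    (mk_mem_span_standard hk hkn _)
  exact fun h => h hmem

theorem isGroebnerBasis_groebnerSet (hk : 0 < k) (hkn : k ≤ n) :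
    IsGroebnerBasis (neglex n) (groebnerSet n k) (idealI n k) where
  finite := finite_groebnerSet n k
  subset g hg := (groebnerSet_subset hkn hg).1
  ne_zero g hg := (groebnerSet_subset hkn hg).2
  span_initial := by
    refine le_antisymm (Ideal.span_le.2 ?_) (Ideal.span_mono ?_)
    · rintro _ ⟨f, hf, hf0, rfl⟩
      -- A leading monomial of the ideal is not standard, hence not substaircase, hence divisible by
      -- the leading monomial of some element of the set.
      have h1 : ¬ IsSubstaircase n k ((neglex n).degree f) := by
        rw [← monomial_notMem_initialIdeal_iff hk hkn, not_not]
        exact Ideal.subset_span ⟨f, hf, hf0, rfl⟩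
      obtain ⟨g, hg, hle⟩ : ∃ g ∈ groebnerSet n k, (neglex n).degree g ≤ (neglex n).degree f := by
        by_contra! h
        exact h1 (isSubstaircase_of_forall_not_le hk hkn _ h)
      have h2 : initialMonomial (neglex n) f =
          monomial ((neglex n).degree f - (neglex n).degree g) 1 * initialMonomial (neglex n) g := by
        rw [initialMonomial, initialMonomial, monomial_mul, tsub_add_cancel_of_le hle, one_mul]
      rw [h2]
      exact Ideal.mul_mem_left _ _ (Ideal.subset_span ⟨g, hg, rfl⟩)
    · rintro _ ⟨g, hg, rfl⟩
      exact ⟨g, (groebnerSet_subset hkn hg).1, (groebnerSet_subset hkn hg).2, rfl⟩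

/-- Substaircase exponents and substaircase monomials are in bijection. -/
def substaircaseEquiv (n k : ℕ) :
    {a : Fin n →₀ ℕ // IsSubstaircase n k a} ≃ substaircaseMonomials n k :=
  Equiv.ofBijective (fun a => ⟨monomial a.1 1, a.1, a.2, rfl⟩) <| by
    constructor
    · intro a b h
      exact Subtype.ext (monomial_left_injective one_ne_zero (congrArg Subtype.val h))
    · rintro ⟨_, a, ha, rfl⟩
      exact ⟨⟨a, ha⟩, rfl⟩

end Main

end OrbitHarmonics
end

/-! ### The main theorem -/

open OrbitHarmonics in
theorem theorem2p4 (n k : ℕ) (hk : 0 < k) (hkn : k ≤ n)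
    (α : Fin k → ℂ) (hα : Function.Injective α) :
    grIdeal (MvPolynomial.vanishingIdeal ℂ (locusZ n k α)) = idealI n k ∧
    Nonempty ((repR n k).Equiv (repFubini n k)) ∧
    IsGroebnerBasis (neglex n) (groebnerSet n k) (idealI n k) ∧
    substaircaseMonomials n k = standardMonomials (neglex n) (idealI n k) ∧
    ∃ B : Module.Basis (substaircaseMonomials n k) ℂ (ringR n k),
      ∀ p : substaircaseMonomials n k, B p = Ideal.Quotient.mk (idealI n k) p := by
  have := finite_ringR hk hkn
  obtain ⟨ψ, hsurj, hequiv, hker⟩ := exists_surjective_intertwining (n := n) hk α hα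
  -- Equal dimensions make `ψ` injective. It is then the isomorphism of representations, and since
  -- its kernel is `gr I(Z)` modulo $I_{n,k}$, the two ideals coincide.
  have hinj : Function.Injective ψ := by
    have : Module.Finite ℂ (MonoidAlgebra ℂ (FubiniWord n k)) := Module.Finite.of_surjective ψ hsurj
    refine (LinearMap.injective_iff_surjective_of_finrank_eq_finrank ?_).2 hsurj
    rw [finrank_ringR hk hkn, finrank_monoidAlgebra_fubiniWord]
  refine ⟨le_antisymm (fun f hf => ?_) (idealI_le_grIdeal α hk),
    ⟨Representation.Equiv.mk (LinearEquiv.ofBijective ψ ⟨hinj, hsurj⟩) hequiv⟩,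
    isGroebnerBasis_groebnerSet hk hkn, ?_, ?_⟩
  · rw [← Ideal.Quotient.eq_zero_iff_mem]
    exact hinj (((hker f).2 hf).trans (map_zero ψ).symm)
  · ext p
    constructor
    · rintro ⟨a, ha, rfl⟩
      exact ⟨a, rfl, (monomial_notMem_initialIdeal_iff hk hkn a).2 ha⟩
    · rintro ⟨a, rfl, ha⟩
      exact ⟨a, (monomial_notMem_initialIdeal_iff hk hkn a).1 ha, rfl⟩
  · refine ⟨(Module.Basis.mk (linearIndependent_substaircaseClass hk hkn)
      (span_substaircaseClass hk hkn)).reindex (substaircaseEquiv n k), fun p => ?_⟩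
    obtain ⟨a, rfl⟩ := (substaircaseEquiv n k).surjective p
    rw [Module.Basis.reindex_apply, Equiv.symm_apply_apply, Module.Basis.mk_apply]
    rfl
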